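/- **Setting.** Let $\mathcal P_1$ be the set of continuous (atomless) probability distributions on $\mathbb R$ with a finite first moment; $\mu_p$ and $\sigma_p$ denote mean and standard deviation. For $p\in\mathcal P_1$ and $t\in(0,1)$, the $t$-trimmed version of $p$ is $p$ conditioned on $[\mu_p-r,\mu_p+r]$, where $r\ge 0$ is chosen so that this interval has $p$-mass $1-t$. For real $m>0$ and $\delta\in(0,1)$ let $p^*_{m,\delta}$ be the $\frac{0.45}{m}\log\frac1\delta$-trimmed version of $p$ and $$\epsilon_{m,\delta}(p)=|\mu_p-\mu_{p^*_{m,\delta}}|+\sigma_{p^*_{m,\delta}}\sqrt{\tfrac{4.5\log(1/\delta)}{m}} .$$ Let $d_H^2(p,q)=\frac12\int(\sqrt{dp}-\sqrt{dq})^2$. For $p\in\mathcal P_1$ let $N_{n,\delta}(p)$ be the set of $q\in\mathcal P_1$ such that 1. $\epsilon_{n/3,\delta}(q)\le 100\,\epsilon_{n,\delta}(p)$, 2. $\log(1-d_H^2(p,q))\ge\frac1{2n}\log 4\delta$ (with $\log 0=-\infty$), 3. $|\mu_q-\mu_p|\le\epsilon_{n,\delta}(p)$, 4. $q\ll p$ and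 $\frac{dq}{dp}\le 2$ ($p$-almost everywhere). An estimator is a measurable map $\hat\mu:\mathbb R^n\to\mathbb R$, applied to $n$ i.i.d. samples. Given a neighborhood function $N:\mathcal P_1\to 2^{\mathcal P_1}$, a function $e:\mathcal P_1\to[0,\infty)$ is a *neighborhood Pareto bound* (for $n,\delta$) with respect to $N$ if for no $p\in\mathcal P_1$ there is an estimator $\hat\mu$ such that both (i) for every $q\in N(p)$, $|\hat\mu-\mu_q|\le e(q)$ with probability at least $1-\delta$ over $n$ i.i.d. samples from $q$, and (ii) $|\hat\mu-\mu_p|<e(p)$ with probability at least $1-\delta$ over $n$ i.i.d. samples from $p$. For $\kappa,\tau>1$, an estimator $\hat\mu$ is *$(\kappa,\tau)$-neighborhood optimal* with respect to $N$, witnessed by error functions $e_m:\mathcal P_1\to[0,\infty)$ ($m$ real), if $\min(e_{n/\tau},e_n)$ is a neighborhood Pareto bound with respect to $N$ and, for every $p\in\mathcal P_1$, $|\hat\mu-\mu_p|\le\kappa\, e_n(p)$ with probability at least $1-\delta$ over $n$ i.i.d. samples from $p$. The median-of-means estimator divides the samples into $k=\lceil 4.5\log\frac1\delta\rceil$ groups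 of equal size $\lfloor n/k\rfloor$ (dropping the remaining samples) and returns the median of the group means (the average of the two middle values if $k$ is even). **Theorem.** There are absolute constants $c>0$ and $\kappa_0,\kappa_1>1$ such that for all integers $n\ge1$ and all $\delta>0$ with $\delta\le c$ and $\frac{\log(1/\delta)}{n}\le c$: * for every $\kappa\ge\kappa_0$, the function $\frac1\kappa\min(\epsilon_{n/3,\delta},\epsilon_{n,\delta})$ is a neighborhood Pareto bound with respect to $N_{n,\delta}$; * for every $\kappa\ge\kappa_1$, the median-of-means estimator is $(\kappa,3)$-neighborhood optimal with respect to $N_{n,\delta}$, witnessed by the error functions $\frac1{\kappa_0}\epsilon_{m,\delta}$. -/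

import Mathlib

open MeasureTheory ProbabilityTheory Set

noncomputable section

namespace MeanEst

/-- The class `𝒫₁`: continuous (that is, atomless) probability distributions on `ℝ` with a finite
first moment. -/
def FiniteMean (p : Measure ℝ) : Prop :=
  IsProbabilityMeasure p ∧ (∀ x, p {x} = 0) ∧ Integrable (fun x : ℝ => x) p

/-- `𝒫₁` as a type. -/
abbrev P1 : Type := {p : Measure ℝ // FiniteMean p}

/-- The mean `μ_p`. -/
def mean (p : Measure ℝ) : ℝ := ∫ x, x ∂p

/-- The standard deviation `σ_p`. -/
def stdDev (p : Measure ℝ) : ℝ := Real.sqrt (variance (fun x : ℝ => x) p)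

/-- The interval `[μ_p - r, μ_p + r]`. -/
def centered (p : Measure ℝ) (r : ℝ) : Set ℝ := Icc (mean p - r) (mean p + r)

/-- `r` is a `t`-trimming radius of `p`: the interval `[μ_p - r, μ_p + r]` has mass `1 - t`. -/
def IsTrimRadius (p : Measure ℝ) (t r : ℝ) : Prop :=
  0 ≤ r ∧ p.real (centered p r) = 1 - t

/-- Trimming radii exist for all distributions in the class. -/
theorem exists_isTrimRadius {p : Measure ℝ} (hp : FiniteMean p) {t : ℝ} (h0 : 0 < t) (h1 : t ≤ 1) :
    ∃ r, IsTrimRadius p t r := by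
  obtain ⟨hP, hA, -⟩ := hp
  have : NullSingletonClass p := ⟨hA⟩
  set μ := mean p with hμ
  have hint : ∀ a b, IntervalIntegrable (fun _ : ℝ => (1 : ℝ)) p a b := fun a b =>
    (integrable_const (1 : ℝ)).intervalIntegrable
  have hc : Continuous fun r : ℝ => ∫ _ in (μ - r)..(μ + r), (1 : ℝ) ∂p := by
    have h := intervalIntegral.continuous_primitive hint 0
    have e : (fun r : ℝ => ∫ _ in (μ - r)..(μ + r), (1 : ℝ) ∂p)
        = fun r => (∫ _ in (0 : ℝ)..(μ + r), (1 : ℝ) ∂p) - ∫ _ in (0 : ℝ)..(μ - r), (1 : ℝ) ∂p := by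
      ext r
      rw [intervalIntegral.integral_interval_sub_left (hint _ _) (hint _ _)]
    rw [e]
    exact (h.comp (by fun_prop)).sub (h.comp (by fun_prop))
  have hv : ∀ r, 0 ≤ r → ∫ _ in (μ - r)..(μ + r), (1 : ℝ) ∂p = p.real (centered p r) := by
    intro r hr
    rw [intervalIntegral.integral_of_le (by linarith), centered, ← hμ,
      ← integral_Icc_eq_integral_Ioc]
    simp
  have hlim : Filter.Tendsto (fun k : ℕ => p.real (centered p k)) Filter.atTop (nhds 1) := by
    have hU : (⋃ k : ℕ, centered p k) = univ := by
      ext x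
      simp only [mem_iUnion, mem_univ, iff_true, centered, mem_Icc]
      obtain ⟨k, hk⟩ := exists_nat_ge |x - mean p|
      have := abs_le.1 hk
      exact ⟨k, by linarith, by linarith⟩
    have hm : Monotone fun k : ℕ => centered p k := by
      intro a b hab
      have : (a : ℝ) ≤ b := by exact_mod_cast hab
      exact Icc_subset_Icc (by linarith) (by linarith)
    have h := tendsto_measure_iUnion_atTop (μ := p) hm
    rw [hU, measure_univ] at h
    have h' := (ENNReal.tendsto_toReal ENNReal.one_ne_top).comp h
    rwa [ENNReal.toReal_one] at h'
  obtain ⟨k, hk⟩ := (hlim.eventually (lt_mem_nhds (show 1 - t < 1 by linarith))).exists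
  have hk0 : (0 : ℝ) ≤ k := Nat.cast_nonneg k
  obtain ⟨r, hr, hr'⟩ := intermediate_value_Icc hk0 hc.continuousOn
    (show 1 - t ∈ _ by
      refine ⟨by simpa using h1, ?_⟩
      rw [hv k hk0]
      exact hk.le)
  exact ⟨r, hr.1, by rw [← hv r hr.1]; exact hr'⟩

/-- A selected `t`-trimming radius. It exists for atomless `p` and `0 < t ≤ 1`
(`exists_isTrimRadius`), and two trimming radii give intervals that differ by a null set. -/
def trimRadius (p : Measure ℝ) (t : ℝ) : ℝ := Classical.epsilon (IsTrimRadius p t)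

/-- The `t`-trimmed version of `p`: `p` conditioned on `[μ_p - r, μ_p + r]`. -/
def trimmed (p : Measure ℝ) (t : ℝ) : Measure ℝ := 
  ProbabilityTheory.cond p (centered p (trimRadius p t))

/-- The trimmed distribution `p*_{m,δ}`, trimmed by the mass `(0.45 / m) log (1/δ)`. The sample size
`m` is a real number, since it is also used with `m = n / 3`. -/
def pStar (m δ : ℝ) (p : Measure ℝ) : Measure ℝ := trimmed p (0.45 / m * Real.log (1 / δ))

/-- The error function
`ε_{m,δ}(p) = |μ_p - μ_{p*}| + σ_{p*} √(4.5 log (1/δ) / m)`, where `p* = p*_{m,δ}`. -/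
def errFn (m δ : ℝ) (p : P1) : ℝ :=
  |mean p.1 - mean (pStar m δ p.1)| +
    stdDev (pStar m δ p.1) * Real.sqrt (4.5 * Real.log (1 / δ) / m)

/-- The squared Hellinger distance `½ ∫ (√dp - √dq)²`, computed with densities with respect to the
dominating measure `p + q`. -/
def hellingerSq (p q : Measure ℝ) : ℝ :=
  1 / 2 * ∫ x, (Real.sqrt (p.rnDeriv (p + q) x).toReal
    - Real.sqrt (q.rnDeriv (p + q) x).toReal) ^ 2 ∂(p + q)

/-- The neighborhood `N_{n,δ}(p)`. The clause `hellingerSq p q < 1` only says that the logarithm is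
not `log 0 = -∞`. The last two clauses say that `dq/dp` exists and is at most `2`. -/
def nbhd (n : ℕ) (δ : ℝ) (p : P1) : Set P1 :=
  {q | errFn ((n : ℝ) / 3) δ q ≤ 100 * errFn n δ p ∧
    (hellingerSq p.1 q.1 < 1 ∧
      1 / (2 * (n : ℝ)) * Real.log (4 * δ) ≤ Real.log (1 - hellingerSq p.1 q.1)) ∧
    |mean q.1 - mean p.1| ≤ errFn n δ p ∧
    (q.1 ≪ p.1 ∧ ∀ᵐ x ∂p.1, q.1.rnDeriv p.1 x ≤ 2)}

/-- An `n`-sample estimator. -/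
abbrev Estimator (n : ℕ) : Type := (Fin n → ℝ) → ℝ

/-- The law of `n` i.i.d. samples from `p`. -/
def samples (n : ℕ) (p : P1) : Measure (Fin n → ℝ) := Measure.pi fun _ => p.1

/-- With probability at least `1 - δ` over `n` i.i.d. samples from `p`, the estimate is within
`e` of `μ_p`. -/
def ErrorLE {n : ℕ} (δ : ℝ) (μhat : Estimator n) (p : P1) (e : ℝ) : Prop :=
  1 - δ ≤ (samples n p).real {x | |μhat x - mean p.1| ≤ e}

/-- As `ErrorLE`, with a strict inequality for the error. -/
def ErrorLT {n : ℕ} (δ : ℝ) (μhat : Estimator n) (p : P1) (e : ℝ) : Prop :=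
  1 - δ ≤ (samples n p).real {x | |μhat x - mean p.1| < e}

/-- The error function `e` is a neighborhood Pareto bound for `𝒫₁` with respect to `N`. -/
def IsParetoBound (n : ℕ) (δ : ℝ) (N : P1 → Set P1) (e : P1 → ℝ) : Prop :=
  (∀ p, 0 ≤ e p) ∧
    ∀ p, ¬ ∃ μhat : Estimator n, Measurable μhat ∧
      (∀ q ∈ N p, ErrorLE δ μhat q (e q)) ∧ ErrorLT δ μhat p (e p)

/-- `μhat` is `(κ, τ)`-neighborhood optimal with respect to `N`, as witnessed by the family of error
functions `e` (indexed by the real sample size). -/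
def IsNbhdOptimalVia (κ τ : ℝ) (n : ℕ) (δ : ℝ) (N : P1 → Set P1) (μhat : Estimator n)
    (e : ℝ → P1 → ℝ) : Prop :=
  1 < κ ∧ 1 < τ ∧ Measurable μhat ∧ (∀ m p, 0 ≤ e m p) ∧
    IsParetoBound n δ N (fun p => min (e ((n : ℝ) / τ) p) (e n p)) ∧
    ∀ p, ErrorLE δ μhat p (κ * e n p)

/-- `μhat` is `(κ, τ)`-neighborhood optimal with respect to `N`. -/
def IsNbhdOptimal (κ τ : ℝ) (n : ℕ) (δ : ℝ) (N : P1 → Set P1) (μhat : Estimator n) : Prop :=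
  ∃ e : ℝ → P1 → ℝ, IsNbhdOptimalVia κ τ n δ N μhat e

/-- The median of `k` reals: the average of the two middle order statistics, which coincide when
`k` is odd (and `0` for `k = 0`). -/
def median {k : ℕ} (v : Fin k → ℝ) : ℝ :=
  if h : 0 < k then
    (v (Tuple.sort v ⟨(k - 1) / 2, by omega⟩) + v (Tuple.sort v ⟨k / 2, by omega⟩)) / 2
  else 0

/-- The number of groups, `4.5 log (1/δ)` rounded up. -/
def numGroups (δ : ℝ) : ℕ := ⌈4.5 * Real.log (1 / δ)⌉₊

/-- Median-of-means: split the samples into `k` consecutive groups of the same size `b = ⌊n / k⌋`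
(the at most `k - 1` remaining samples are dropped) and take the median of the group means. -/
def medianOfMeans (n : ℕ) (δ : ℝ) : Estimator n := fun x =>
  let k := numGroups δ
  let b := n / k
  median fun j : Fin k => (∑ i : Fin n with i.val / b = j.val, x i) / b

end MeanEst

end

/-!
Throughout, `x = log (1/δ) / n`, and the error function of `p` is, up to constants, the sum of the
bias `|μ_p - μ_{p*}|` of trimming a mass `≈ x` and of the deviation `σ_{p*} √x`.

*Lower bound.* An estimator that beats the bound at `p` and meets it on the neighborhood is a test
between `p` and any neighbor `q` whose mean is far enough away. If both error probabilities of a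
test based on `n` samples are at most `δ`, then the Bhattacharyya coefficient satisfies
`(1 - d_H²)^n < 2 √δ` (`bhattacharyya_pow_lt`), which the Hellinger condition of the neighborhood
rules out. So it suffices to find a neighbor whose mean differs from that of `p` by a constant
fraction of the error function (`exists_tilt_mem_nbhd`). The neighbors are tilts `(1 + φ) p` with
`|φ| ≤ 1`, `∫ φ ∂p = 0` and `∫ φ² ∂p ≤ x / 2`; such a tilt is close to `p` in Hellinger distance
(`hellingerSq_tilt_le`), and `φ` can be scaled to limit the shift of the mean. A suitable
`φ` (`exists_direction_ge`) comes from trimming if the bias dominates; from a linear function on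
the trimming interval if the deviation dominates and the trimming radius is at most `σ / √x`; and
from thinning out one of the tails beyond a larger trimming radius otherwise. The remaining
condition, that the error function of the tilt at sample size `n / 3` is not much larger, is
`errAt_tilt_le`. The triple trimming level is what makes it true: a tilt has mass at most `0.9 x`
outside the trimming interval of `p`, and trimming at level `1.35 x` must cut away points inside
that interval, so the new radius is controlled by the variance of the trimmed distribution.

*Upper bound.* The mean of one group is off by more than ten times the error function with
probability at most `0.16` (`measureReal_groupMean_le`): with `4.5 log (1/δ)` groups, all samples of
a group lie in the trimming interval with probability at least `0.9`, and Chebyshev's inequality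
applies to the truncated samples. If the median is off, so are half of the groups
(`le_two_mul_card_of_lt_abs_median_sub`). By independence of the groups this has probability at most
`2^k * 0.16^(k/2) = 0.8^k ≤ δ`.
-/

namespace MeanEst

/-! ### Trimmed distributions -/

theorem FiniteMean.isProbabilityMeasure {p : Measure ℝ} (hp : FiniteMean p) :
    IsProbabilityMeasure p := hp.1

theorem isTrimRadius_trimRadius {p : Measure ℝ} (hp : FiniteMean p) {t : ℝ} (h0 : 0 < t)
    (h1 : t ≤ 1) : IsTrimRadius p t (trimRadius p t) :=
  Classical.epsilon_spec (exists_isTrimRadius hp h0 h1)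

theorem measurableSet_centered (p : Measure ℝ) (r : ℝ) : MeasurableSet (centered p r) :=
  measurableSet_Icc

theorem mem_centered {p : Measure ℝ} {r y : ℝ} : y ∈ centered p r ↔ |y - mean p| ≤ r := by
  rw [centered, mem_Icc, abs_le]
  constructor <;> rintro ⟨h, h'⟩ <;> constructor <;> linarith

theorem integrableOn_centered {p : Measure ℝ} [IsFiniteMeasure p] {f : ℝ → ℝ} (hf : Continuous f)
    (q : Measure ℝ) (r : ℝ) : IntegrableOn f (centered q r) p :=
  hf.integrableOn_Icc

section Trimmed

variable {p : Measure ℝ} {t : ℝ}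

/-- Conditioning on the trimming interval divides by its mass `1 - t`. -/
theorem integral_trimmed (hp : FiniteMean p) (h0 : 0 < t) (h1 : t ≤ 1) (f : ℝ → ℝ) :
    ∫ y, f y ∂(trimmed p t) = (1 - t)⁻¹ * ∫ y in centered p (trimRadius p t), f y ∂p := by
  rw [trimmed, ProbabilityTheory.cond, integral_smul_measure, ENNReal.toReal_inv,
    ← (isTrimRadius_trimRadius hp h0 h1).2, measureReal_def, smul_eq_mul]

theorem measureReal_centered_compl (hp : FiniteMean p) (h0 : 0 < t) (h1 : t ≤ 1) :
    p.real (centered p (trimRadius p t))ᶜ = t := by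
  have := hp.isProbabilityMeasure
  rw [probReal_compl_eq_one_sub (measurableSet_centered _ _),
    (isTrimRadius_trimRadius hp h0 h1).2]
  ring

theorem setIntegral_sub_mean_trimmed (hp : FiniteMean p) (h0 : 0 < t) (h1 : t < 1) (a : ℝ) :
    ∫ y in centered p (trimRadius p t), (y - a) ∂p = (1 - t) * (mean (trimmed p t) - a) := by
  have := hp.isProbabilityMeasure
  have ht : 1 - t ≠ 0 := by linarith
  rw [integral_sub (integrableOn_centered continuous_id' _ _) (integrable_const a), mean,
    integral_trimmed hp h0 h1.le, mul_sub, mul_inv_cancel_left₀ ht, setIntegral_const,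
    (isTrimRadius_trimRadius hp h0 h1.le).2, smul_eq_mul]

theorem sq_stdDev (p : Measure ℝ) : stdDev p ^ 2 = ∫ y, (y - mean p) ^ 2 ∂p := by
  rw [stdDev, Real.sq_sqrt (variance_nonneg _ _), variance_eq_integral aemeasurable_id', mean]

theorem stdDev_nonneg (p : Measure ℝ) : 0 ≤ stdDev p := Real.sqrt_nonneg _

/-- The second moment about `a` on the trimming interval, split into variance and squared bias of
the trimmed distribution. -/
theorem setIntegral_sq_sub (hp : FiniteMean p) (h0 : 0 < t) (h1 : t < 1) (a : ℝ) :
    ∫ y in centered p (trimRadius p t), (y - a) ^ 2 ∂p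
      = (1 - t) * (stdDev (trimmed p t) ^ 2 + (mean (trimmed p t) - a) ^ 2) := by
  have := hp.isProbabilityMeasure
  have ht : 1 - t ≠ 0 := by linarith
  set m := mean (trimmed p t) with hm
  have e : ∀ y : ℝ, (y - a) ^ 2 = (y - m) ^ 2 + (2 * (m - a) * (y - m) + (m - a) ^ 2) := by
    intro y; ring
  rw [integral_congr_ae (Filter.Eventually.of_forall e)]
  rw [integral_add (integrableOn_centered (by fun_prop) _ _)
      (integrableOn_centered (by fun_prop) _ _),
    integral_add (integrableOn_centered (by fun_prop) _ _) (integrable_const _),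
    integral_const_mul, setIntegral_sub_mean_trimmed hp h0 h1, sq_stdDev,
    integral_trimmed hp h0 h1.le, setIntegral_const, (isTrimRadius_trimRadius hp h0 h1.le).2,
    smul_eq_mul, mul_add, mul_inv_cancel_left₀ ht, ← hm]
  ring

theorem setIntegral_sq_sub_nonneg (s : Set ℝ) (a : ℝ) : 0 ≤ ∫ y in s, (y - a) ^ 2 ∂p :=
  integral_nonneg fun _ => sq_nonneg _

end Trimmed

theorem errFn_nonneg (m δ : ℝ) (p : P1) : 0 ≤ errFn m δ p :=
  add_nonneg (abs_nonneg _) (mul_nonneg (stdDev_nonneg _) (Real.sqrt_nonneg _))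

/-! ### Tilted distributions and their Hellinger distance -/

/-- The tilt `(1 + φ) p` of a distribution `p`. It is used for `|φ| ≤ 1` and `∫ φ ∂p = 0`, when it
is a probability measure with density between `0` and `2`. -/
noncomputable def tilt (p : Measure ℝ) (φ : ℝ → ℝ) : Measure ℝ :=
  p.withDensity fun y => ENNReal.ofReal (1 + φ y)

/-- An admissible direction of perturbation: `φ` is measurable, bounded by `1`, and has mean `0`
under `p`. -/
structure IsDirection (p : Measure ℝ) (φ : ℝ → ℝ) : Prop where
  measurable : Measurable φ
  abs_le_one : ∀ y, |φ y| ≤ 1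
  integral_eq_zero : ∫ y, φ y ∂p = 0

section Tilt

variable {p : Measure ℝ} {φ : ℝ → ℝ}

theorem IsDirection.one_add_nonneg (hφ : IsDirection p φ) (y : ℝ) : 0 ≤ 1 + φ y := by
  linarith [(abs_le.1 (hφ.abs_le_one y)).1]

theorem IsDirection.one_add_le_two (hφ : IsDirection p φ) (y : ℝ) : 1 + φ y ≤ 2 := by
  linarith [(abs_le.1 (hφ.abs_le_one y)).2]

theorem IsDirection.measurable_density (hφ : IsDirection p φ) :
    Measurable fun y => ENNReal.ofReal (1 + φ y) :=
  (measurable_const.add hφ.measurable).ennreal_ofReal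

theorem IsDirection.integrable_mul (hφ : IsDirection p φ) {f : ℝ → ℝ} (hf : Integrable f p) :
    Integrable (fun y => φ y * f y) p :=
  hf.bdd_mul (c := 1) hφ.measurable.aestronglyMeasurable (by
    filter_upwards with y using by simpa using hφ.abs_le_one y)

theorem IsDirection.integrable [IsFiniteMeasure p] (hφ : IsDirection p φ) : Integrable φ p := by
  simpa using hφ.integrable_mul (integrable_const (1 : ℝ))

theorem IsDirection.integrable_const_add [IsFiniteMeasure p] (hφ : IsDirection p φ) (c : ℝ) :
    Integrable (fun y => c + φ y) p :=
  (integrable_const c).add hφ.integrable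

theorem IsDirection.integrable_sq [IsFiniteMeasure p] (hφ : IsDirection p φ) :
    Integrable (fun y => φ y ^ 2) p := by
  simpa [sq] using hφ.integrable_mul hφ.integrable

theorem integral_tilt (hφ : IsDirection p φ) (f : ℝ → ℝ) :
    ∫ y, f y ∂(tilt p φ) = ∫ y, (1 + φ y) * f y ∂p := by
  rw [tilt, integral_withDensity_eq_integral_toReal_smul hφ.measurable_density (by simp)]
  simp [ENNReal.toReal_ofReal (hφ.one_add_nonneg _)]

theorem setIntegral_tilt (hφ : IsDirection p φ) (f : ℝ → ℝ) {s : Set ℝ} (hs : MeasurableSet s) :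
    ∫ y in s, f y ∂(tilt p φ) = ∫ y in s, (1 + φ y) * f y ∂p := by
  rw [tilt, setIntegral_withDensity_eq_setIntegral_toReal_smul hφ.measurable_density (by simp) _ hs]
  simp [ENNReal.toReal_ofReal (hφ.one_add_nonneg _)]

theorem tilt_absolutelyContinuous : tilt p φ ≪ p := withDensity_absolutelyContinuous _ _

theorem tilt_le (hφ : IsDirection p φ) : tilt p φ ≤ (2 : ENNReal) • p := by
  rw [← withDensity_const]
  refine withDensity_mono (Filter.Eventually.of_forall fun y => ?_)
  calc ENNReal.ofReal (1 + φ y) ≤ ENNReal.ofReal 2 :=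
        ENNReal.ofReal_le_ofReal (hφ.one_add_le_two y)
    _ = 2 := by norm_num

theorem finiteMean_tilt (hp : FiniteMean p) (hφ : IsDirection p φ) : FiniteMean (tilt p φ) := by
  have := hp.isProbabilityMeasure
  refine ⟨⟨?_⟩, fun x => tilt_absolutelyContinuous (hp.2.1 x),
    Integrable.mono_measure (hp.2.2.smul_measure (by simp)) (tilt_le hφ)⟩
  rw [tilt, withDensity_apply _ MeasurableSet.univ, Measure.restrict_univ,
    ← ofReal_integral_eq_lintegral_ofReal (hφ.integrable_const_add 1)
      (Filter.Eventually.of_forall hφ.one_add_nonneg),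
    integral_add (integrable_const 1) hφ.integrable, hφ.integral_eq_zero]
  simp

theorem mean_tilt_sub_mean (hp : FiniteMean p) (hφ : IsDirection p φ) :
    mean (tilt p φ) - mean p = ∫ y, φ y * y ∂p := by
  rw [mean, integral_tilt hφ, mean]
  simp_rw [add_mul, one_mul]
  rw [integral_add hp.2.2 (hφ.integrable_mul hp.2.2)]
  ring

theorem measureReal_tilt_le (hp : FiniteMean p) (hφ : IsDirection p φ) (s : Set ℝ) :
    (tilt p φ).real s ≤ 2 * p.real s := by
  have := hp.isProbabilityMeasure
  have h := tilt_le hφ s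
  rw [Measure.smul_apply, smul_eq_mul] at h
  have h2 := ENNReal.toReal_mono (ENNReal.mul_ne_top (by simp) (measure_ne_top p s)) h
  simpa [measureReal_def] using h2

theorem rnDeriv_tilt_le (hp : FiniteMean p) (hφ : IsDirection p φ) :
    ∀ᵐ y ∂p, (tilt p φ).rnDeriv p y ≤ 2 := by
  have := hp.isProbabilityMeasure
  filter_upwards [Measure.rnDeriv_withDensity p hφ.measurable_density] with y hy
  rw [tilt, hy]
  calc ENNReal.ofReal (1 + φ y) ≤ ENNReal.ofReal 2 :=
        ENNReal.ofReal_le_ofReal (hφ.one_add_le_two y)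
    _ = 2 := by norm_num

theorem hellingerSq_tilt (hp : FiniteMean p) (hφ : IsDirection p φ) :
    hellingerSq p (tilt p φ) = 1 / 2 * ∫ y, (1 - Real.sqrt (1 + φ y)) ^ 2 ∂p := by
  have := hp.isProbabilityMeasure
  have := (finiteMean_tilt hp hφ).isProbabilityMeasure
  set s := p + tilt p φ with hs
  have hps : p ≪ s := Measure.absolutelyContinuous_of_le (Measure.le_add_right le_rfl)
  have hp' : s.withDensity (p.rnDeriv s) = p := Measure.withDensity_rnDeriv_eq _ _ hps
  have hq : tilt p φ
      = s.withDensity (p.rnDeriv s * fun y => ENNReal.ofReal (1 + φ y)) := by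
    rw [withDensity_mul _ (Measure.measurable_rnDeriv _ _) hφ.measurable_density, hp', tilt]
  have hq' : (tilt p φ).rnDeriv s
      =ᵐ[s] p.rnDeriv s * fun y => ENNReal.ofReal (1 + φ y) := by
    conv_lhs => rw [hq]
    exact Measure.rnDeriv_withDensity _
      ((Measure.measurable_rnDeriv _ _).mul hφ.measurable_density)
  have hint : ∫ y, (1 - Real.sqrt (1 + φ y)) ^ 2 ∂p
      = ∫ y, (p.rnDeriv s y).toReal * (1 - Real.sqrt (1 + φ y)) ^ 2 ∂s := by
    conv_lhs => rw [← hp']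
    rw [integral_withDensity_eq_integral_toReal_smul (Measure.measurable_rnDeriv _ _)
      (Measure.rnDeriv_lt_top _ _)]
    rfl
  rw [hellingerSq, ← hs, hint]
  congr 1
  refine integral_congr_ae ?_
  filter_upwards [hq'] with y hy
  rw [hy, Pi.mul_apply, ENNReal.toReal_mul, ENNReal.toReal_ofReal (hφ.one_add_nonneg y),
    Real.sqrt_mul ENNReal.toReal_nonneg, ← mul_one_sub, mul_pow, Real.sq_sqrt ENNReal.toReal_nonneg]

theorem IsDirection.integrable_sqrt [IsFiniteMeasure p] (hφ : IsDirection p φ) :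
    Integrable (fun y => Real.sqrt (1 + φ y)) p := by
  refine Integrable.mono' (integrable_const (2 : ℝ))
    (measurable_const.add hφ.measurable).sqrt.aestronglyMeasurable
    (Filter.Eventually.of_forall fun y => ?_)
  rw [Real.norm_of_nonneg (Real.sqrt_nonneg _), Real.sqrt_le_left (by norm_num)]
  linarith [hφ.one_add_le_two y]

/-- The Bhattacharyya coefficient of `p` and its tilt is `1 - d_H²`. -/
theorem one_sub_hellingerSq_tilt (hp : FiniteMean p) (hφ : IsDirection p φ) :
    1 - hellingerSq p (tilt p φ) = ∫ y, Real.sqrt (1 + φ y) ∂p := by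
  have := hp.isProbabilityMeasure
  have e : ∀ y, (1 - Real.sqrt (1 + φ y)) ^ 2 = (2 + φ y) - 2 * Real.sqrt (1 + φ y) := by
    intro y
    have := Real.sq_sqrt (hφ.one_add_nonneg y)
    linear_combination this
  rw [hellingerSq_tilt hp hφ]
  simp_rw [e]
  rw [integral_sub (hφ.integrable_const_add 2) (hφ.integrable_sqrt.const_mul 2),
    integral_add (integrable_const _) hφ.integrable, hφ.integral_eq_zero, integral_const_mul]
  simp
  ring

theorem hellingerSq_tilt_le (hp : FiniteMean p) (hφ : IsDirection p φ) :
    hellingerSq p (tilt p φ) ≤ 1 / 2 * ∫ y, φ y ^ 2 ∂p := by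
  have := hp.isProbabilityMeasure
  rw [hellingerSq_tilt hp hφ]
  refine mul_le_mul_of_nonneg_left (integral_mono_of_nonneg
    (Filter.Eventually.of_forall fun y => sq_nonneg _) hφ.integrable_sq
    (Filter.Eventually.of_forall fun y => ?_)) (by norm_num)
  have h1 := Real.sq_sqrt (hφ.one_add_nonneg y)
  have h2 := Real.sqrt_nonneg (1 + φ y)
  set w := Real.sqrt (1 + φ y)
  -- `φ = (w - 1) (w + 1)` with `w + 1 ≥ 1`
  have h3 : φ y = (w - 1) * (w + 1) := by linear_combination -h1
  change (1 - w) ^ 2 ≤ φ y ^ 2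
  rw [h3, mul_pow, show (1 - w) ^ 2 = (w - 1) ^ 2 by ring]
  exact le_mul_of_one_le_right (sq_nonneg _) (one_le_pow₀ (by linarith))

end Tilt

/-! ### The two-point testing bound -/

section TwoPoint

variable {p : Measure ℝ} {φ : ℝ → ℝ} {n : ℕ}

/-- The product of the tilts has density `∏ i, (1 + φ (x i))` with respect to the product. -/
theorem pi_tilt (hp : FiniteMean p) (hφ : IsDirection p φ) :
    Measure.pi (fun _ : Fin n => tilt p φ) = (Measure.pi fun _ : Fin n => p).withDensity
      fun x => ENNReal.ofReal (∏ i, (1 + φ (x i))) := by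
  have := hp.isProbabilityMeasure
  have := (finiteMean_tilt hp hφ).isProbabilityMeasure
  refine Measure.pi_eq fun s hs => ?_
  have hi : ∀ i : Fin n, Integrable (fun y => 1 + φ y) (p.restrict (s i)) := fun i =>
    (hφ.integrable_const_add 1).integrableOn
  rw [withDensity_apply _ (MeasurableSet.univ_pi hs), Measure.restrict_pi_pi,
    ← ofReal_integral_eq_lintegral_ofReal
      (Integrable.fintype_prod (f := fun _ y => 1 + φ y) hi)
      (Filter.Eventually.of_forall fun x => Finset.prod_nonneg fun i _ => hφ.one_add_nonneg _),
    integral_fintype_prod_eq_prod (fun _ y => 1 + φ y), ENNReal.ofReal_prod_of_nonneg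
      (fun i _ => integral_nonneg hφ.one_add_nonneg)]
  refine Finset.prod_congr rfl fun i _ => ?_
  rw [tilt, withDensity_apply _ (hs i), ofReal_integral_eq_lintegral_ofReal (hi i)
    (Filter.Eventually.of_forall hφ.one_add_nonneg)]

/-- A test that separates `p^n` from its tilt with both error probabilities at most `d²` forces
the `n`-th power of the Bhattacharyya coefficient below `2 d`. On the acceptance region the square
root of the likelihood ratio `G` is bounded by `(d + G / d) / 2`, and on its complement by
`(1 / d + d G) / 2`. -/
theorem bhattacharyya_pow_lt (hp : FiniteMean p) (hφ : IsDirection p φ) {A : Set (Fin n → ℝ)}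
    (hA : MeasurableSet A) {d : ℝ} (hd : 0 < d) (hd1 : d ≤ 1)
    (hP : 1 - d ^ 2 ≤ (Measure.pi fun _ : Fin n => p).real A)
    (hQ : 1 - d ^ 2 ≤ (Measure.pi fun _ : Fin n => tilt p φ).real Aᶜ) :
    (∫ y, Real.sqrt (1 + φ y) ∂p) ^ n < 2 * d := by
  have := hp.isProbabilityMeasure
  have := (finiteMean_tilt hp hφ).isProbabilityMeasure
  set P := Measure.pi fun _ : Fin n => p with hPdef
  set Q := Measure.pi fun _ : Fin n => tilt p φ with hQdef
  set G : (Fin n → ℝ) → ℝ := fun x => ∏ i, (1 + φ (x i)) with hG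
  have hG0 : ∀ x, 0 ≤ G x := fun x => Finset.prod_nonneg fun i _ => hφ.one_add_nonneg _
  have hGi : Integrable G P :=
    Integrable.fintype_prod (f := fun _ y => 1 + φ y) fun _ => hφ.integrable_const_add 1
  have hsG : ∀ x, Real.sqrt (G x) = ∏ i, Real.sqrt (1 + φ (x i)) := fun x =>
    Real.sqrt_prod _ fun i _ => hφ.one_add_nonneg _
  have hsGi : Integrable (fun x => Real.sqrt (G x)) P := by
    simp_rw [hsG]
    exact Integrable.fintype_prod (f := fun _ y => Real.sqrt (1 + φ y)) fun _ => hφ.integrable_sqrt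
  have hbc : ∫ x, Real.sqrt (G x) ∂P = (∫ y, Real.sqrt (1 + φ y) ∂p) ^ n := by
    simp_rw [hsG]
    rw [hPdef, integral_fintype_prod_eq_prod (fun _ y => Real.sqrt (1 + φ y))]
    simp
  have hQr : ∀ B, MeasurableSet B → Q.real B = ∫ x in B, G x ∂P := by
    intro B hB
    rw [measureReal_def, hQdef, pi_tilt hp hφ, withDensity_apply _ hB,
      ← ofReal_integral_eq_lintegral_ofReal hGi.integrableOn
        (Filter.Eventually.of_forall hG0),
      ENNReal.toReal_ofReal (integral_nonneg hG0)]
  -- the arithmetic-geometric mean inequality, integrated over a set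
  have key : ∀ (B : Set (Fin n → ℝ)) (c : ℝ), MeasurableSet B → 0 < c →
      ∫ x in B, Real.sqrt (G x) ∂P ≤ 1 / 2 * (c * P.real B + 1 / c * Q.real B) := by
    intro B c hB hc
    have hle : ∫ x in B, Real.sqrt (G x) ∂P ≤ ∫ x in B, (c / 2 + 1 / (2 * c) * G x) ∂P := by
      refine integral_mono hsGi.integrableOn
        ((integrable_const _).add (hGi.integrableOn.const_mul _)) fun x => ?_
      have h1 := Real.sq_sqrt (hG0 x)
      have h2 : c / 2 + 1 / (2 * c) * G x - Real.sqrt (G x)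
          = (c - Real.sqrt (G x)) ^ 2 / (2 * c) := by
        field_simp
        linear_combination -h1
      have h3 : 0 ≤ (c - Real.sqrt (G x)) ^ 2 / (2 * c) := by positivity
      change Real.sqrt (G x) ≤ c / 2 + 1 / (2 * c) * G x
      linarith
    rw [integral_add (integrable_const _) (hGi.integrableOn.const_mul _), integral_const_mul,
      ← hQr B hB, setIntegral_const, smul_eq_mul] at hle
    refine hle.trans (le_of_eq ?_)
    field_simp
  have h1 := key A d hA hd
  have h2 := key Aᶜ (1 / d) hA.compl (by positivity)
  have h3 := integral_add_compl hA hsGi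
  have hPc := probReal_compl_eq_one_sub (μ := P) hA
  have hQc := probReal_compl_eq_one_sub (μ := Q) hA
  rw [hPc, one_div_one_div] at h2
  rw [hQc] at h2 hQ
  rw [← hbc, ← h3]
  set a := P.real A
  set b := Q.real A
  have hud : 0 ≤ 1 / d - d := by
    rw [sub_nonneg, le_div_iff₀ hd]
    nlinarith
  have e : ∀ u : ℝ, 1 - d ^ 2 ≤ u → d * u + 1 / d * (1 - u) ≤ 2 * d - d ^ 3 := by
    intro u hu
    have h : d * u + 1 / d * (1 - u) - (2 * d - d ^ 3) = -((u - (1 - d ^ 2)) * (1 / d - d)) := by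
      field_simp
      ring
    have := mul_nonneg (sub_nonneg.2 hu) hud
    linarith
  have e1 := e a hP
  have e2 := e (1 - b) hQ
  have : 0 < d ^ 3 := by positivity
  rw [sub_sub_cancel] at e2
  linarith

/-- No estimator is accurate at `p` and at a tilt of `p` if the means differ by more than the two
errors together and the distributions cannot be told apart from `n` samples. -/
theorem not_errorLT_of_errorLE_tilt {P Q : P1} (hφ : IsDirection P.1 φ) (hQ : Q.1 = tilt P.1 φ)
    {δ : ℝ} (hδ0 : 0 < δ) (hδ1 : δ ≤ 1) (hn : 0 < n)
    (hH : hellingerSq P.1 Q.1 < 1)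
    (hlog : 1 / (2 * (n : ℝ)) * Real.log (4 * δ) ≤ Real.log (1 - hellingerSq P.1 Q.1))
    {μhat : Estimator n} (hμ : Measurable μhat) {e e' : ℝ}
    (he : e + e' ≤ |mean Q.1 - mean P.1|) (hE : ErrorLE δ μhat Q e) : ¬ ErrorLT δ μhat P e' := by
  intro hE'
  have := (finiteMean_tilt P.2 hφ).isProbabilityMeasure
  have hA : MeasurableSet {x | |μhat x - mean P.1| < e'} :=
    measurableSet_lt (hμ.sub measurable_const).abs measurable_const
  have hd : 0 < Real.sqrt δ := Real.sqrt_pos.2 hδ0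
  have hsq := Real.sq_sqrt hδ0.le
  have hbc := bhattacharyya_pow_lt P.2 hφ hA hd (Real.sqrt_le_one.2 hδ1)
    (by rw [hsq]; exact hE') (by
      rw [hsq]
      refine le_trans (show 1 - δ ≤ (samples n Q).real _ from hE) ?_
      rw [samples, hQ]
      refine measureReal_mono fun x hx => ?_
      simp only [mem_ofPred_eq, mem_compl_iff, not_lt] at hx ⊢
      have := abs_sub_le (mean Q.1) (μhat x) (mean P.1)
      rw [abs_sub_comm (mean Q.1) (μhat x)] at this
      rw [← hQ] at hx
      linarith)
  rw [← one_sub_hellingerSq_tilt P.2 hφ, ← hQ] at hbc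
  have hβ : 0 < 1 - hellingerSq P.1 Q.1 := by linarith
  have h1 := Real.log_lt_log (pow_pos hβ n) hbc
  have h2 : Real.log (4 * δ) = 2 * Real.log (2 * Real.sqrt δ) := by
    rw [← hsq, show 4 * Real.sqrt δ ^ 2 = (2 * Real.sqrt δ) ^ 2 by ring, Real.log_pow,
      Real.sqrt_sq hd.le]
    norm_num
  have hn' : (0 : ℝ) < n := Nat.cast_pos.2 hn
  rw [Real.log_pow] at h1
  rw [h2, show 1 / (2 * (n : ℝ)) * (2 * Real.log (2 * Real.sqrt δ))
    = Real.log (2 * Real.sqrt δ) / n by field_simp, div_le_iff₀ hn'] at hlog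
  linarith

end TwoPoint

/-! ### Directions that move the mean -/

section Directions

variable {p : Measure ℝ} {t : ℝ}

/-- The direction from `p` to its trimmed version, scaled to avoid a division. It shifts the mean
by `1 - t` times the bias of trimming. -/
theorem exists_direction_bias (hp : FiniteMean p) (h0 : 0 < t) (h1 : t < 1) :
    ∃ φ, IsDirection p φ ∧ ∫ y, φ y ^ 2 ∂p ≤ t ∧
      |∫ y, φ y * y ∂p| = (1 - t) * |mean (trimmed p t) - mean p| := by
  have := hp.isProbabilityMeasure
  set I := centered p (trimRadius p t) with hI
  have hIm : MeasurableSet I := measurableSet_centered _ _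
  have hpI : p.real I = 1 - t := (isTrimRadius_trimRadius hp h0 h1.le).2
  have hind : Integrable (I.indicator fun _ => (1 : ℝ)) p :=
    (integrable_const 1).indicator hIm
  have hind' : ∫ y, I.indicator (fun _ => (1 : ℝ)) y ∂p = 1 - t := by
    rw [integral_indicator hIm, setIntegral_const, hpI, smul_eq_mul, mul_one]
  have hind2 : Integrable (I.indicator fun y => y) p := hp.2.2.indicator hIm
  refine ⟨fun y => I.indicator (fun _ => 1) y - (1 - t), ⟨?_, ?_, ?_⟩, ?_, ?_⟩
  · exact (measurable_const.indicator hIm).sub measurable_const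
  · intro y
    by_cases hy : y ∈ I <;> simp [hy, abs_le] <;> constructor <;> linarith
  · rw [integral_sub hind (integrable_const _), hind']
    simp
  · have e : ∀ y, (I.indicator (fun _ => (1 : ℝ)) y - (1 - t)) ^ 2
        = (2 * t - 1) * I.indicator (fun _ => (1 : ℝ)) y + (1 - t) ^ 2 := by
      intro y
      by_cases hy : y ∈ I <;> simp [hy] <;> ring
    rw [integral_congr_ae (Filter.Eventually.of_forall e),
      integral_add (hind.const_mul _) (integrable_const _), integral_const_mul, hind']
    simp
    nlinarith
  · have e : ∀ y, (I.indicator (fun _ => (1 : ℝ)) y - (1 - t)) * y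
        = I.indicator (fun y => y) y - (1 - t) * y := by
      intro y
      by_cases hy : y ∈ I <;> simp [hy] <;> ring
    rw [integral_congr_ae (Filter.Eventually.of_forall e),
      integral_sub hind2 (hp.2.2.const_mul _), integral_const_mul, integral_indicator hIm]
    have h2 := integral_trimmed hp h0 h1.le fun y => y
    have h3 : ∫ y in I, y ∂p = (1 - t) * mean (trimmed p t) := by
      rw [mean, h2, mul_inv_cancel_left₀ (by linarith)]
    rw [h3, ← mean, ← mul_sub, abs_mul, abs_of_pos (by linarith : 0 < 1 - t)]

/-- The linear direction inside the trimming interval, available when the interval is short on the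
scale `σ / a`. -/
theorem exists_direction_linear (hp : FiniteMean p) (h0 : 0 < t) (h1 : t < 1) {a : ℝ}
    (ha : 0 ≤ a) (har : a * trimRadius p t ≤ 1 / 2) :
    ∃ φ, IsDirection p φ ∧ ∫ y, φ y ^ 2 ∂p ≤ a ^ 2 * stdDev (trimmed p t) ^ 2 ∧
      |∫ y, φ y * y ∂p| = a * ((1 - t) * stdDev (trimmed p t) ^ 2) := by
  have := hp.isProbabilityMeasure
  obtain ⟨hr0, hpI⟩ := isTrimRadius_trimRadius hp h0 h1.le
  set I := centered p (trimRadius p t) with hI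
  have hIm : MeasurableSet I := measurableSet_centered _ _
  set m := mean (trimmed p t) with hm
  have hV : ∫ y in I, (y - m) ^ 2 ∂p = (1 - t) * stdDev (trimmed p t) ^ 2 := by
    rw [hI, setIntegral_sq_sub hp h0 h1, ← hm, sub_self]
    ring
  have hM : ∫ y in I, (y - m) ∂p = 0 := by
    rw [hI, setIntegral_sub_mean_trimmed hp h0 h1, ← hm, sub_self, mul_zero]
  -- the mean of the trimmed distribution lies in the trimming interval
  have hmI : |m - mean p| ≤ trimRadius p t := by
    have h2 := setIntegral_sub_mean_trimmed hp h0 h1 (mean p)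
    have h3 : ‖∫ y in I, (y - mean p) ∂p‖ ≤ trimRadius p t * p.real I :=
      norm_setIntegral_le_of_norm_le_const (measure_lt_top _ _) fun y hy => mem_centered.1 hy
    rw [h2, hpI, Real.norm_eq_abs, abs_mul, abs_of_pos (by linarith : 0 < 1 - t), ← hm] at h3
    have : 0 < 1 - t := by linarith
    nlinarith
  have hmul : ∀ y, I.indicator (fun y => a * (y - m)) y * y
      = I.indicator (fun y => a * (y - m) ^ 2 + a * m * (y - m)) y := by
    intro y
    by_cases hy : y ∈ I
    · simp [hy]
      ring
    · simp [hy]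
  have hsq : ∀ y, I.indicator (fun y => a * (y - m)) y ^ 2
      = I.indicator (fun y => a ^ 2 * (y - m) ^ 2) y := by
    intro y
    by_cases hy : y ∈ I
    · simp [hy]
      ring
    · simp [hy]
  refine ⟨I.indicator fun y => a * (y - m), ⟨?_, ?_, ?_⟩, ?_, ?_⟩
  · exact Measurable.indicator (by fun_prop) hIm
  · intro y
    by_cases hy : y ∈ I
    · rw [indicator_of_mem hy, abs_mul, abs_of_nonneg ha]
      have h2 := mem_centered.1 hy
      have h3 := abs_sub_le y (mean p) m
      rw [abs_sub_comm (mean p) m] at h3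
      nlinarith
    · simp [hy]
  · rw [integral_indicator hIm, integral_const_mul, hM, mul_zero]
  · rw [integral_congr_ae (Filter.Eventually.of_forall hsq), integral_indicator hIm,
      integral_const_mul, hV]
    have : 0 ≤ a ^ 2 * stdDev (trimmed p t) ^ 2 := by positivity
    nlinarith
  · rw [integral_congr_ae (Filter.Eventually.of_forall hmul), integral_indicator hIm,
      integral_add (integrableOn_centered (by fun_prop) _ _)
      (integrableOn_centered (by fun_prop) _ _), integral_const_mul, integral_const_mul, hV, hM,
      mul_zero, add_zero, abs_of_nonneg]
    have : 0 < 1 - t := by linarith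
    positivity

/-- Thinning out the heavier of the two tails beyond the trimming interval. -/
theorem exists_direction_tail (hp : FiniteMean p) (h0 : 0 < t) (h1 : t < 1) :
    ∃ φ, IsDirection p φ ∧ ∫ y, φ y ^ 2 ∂p ≤ t ∧
      t / 2 * trimRadius p t ≤ |∫ y, φ y * y ∂p| := by
  have := hp.isProbabilityMeasure
  obtain ⟨hr0, hpI⟩ := isTrimRadius_trimRadius hp h0 h1.le
  have hcompl := measureReal_centered_compl hp h0 h1.le
  set r := trimRadius p t with hr
  set μ := mean p with hμ
  have hsplit : (centered p r)ᶜ ⊆ {y | y < μ - r} ∪ {y | μ + r < y} := by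
    intro y hy
    rw [mem_compl_iff, centered, mem_Icc, not_and_or, not_le, not_le] at hy
    exact hy
  have hsum := (measureReal_mono (μ := p) hsplit).trans (measureReal_union_le _ _)
  rw [hcompl] at hsum
  -- a tail `T` of mass at least `t / 2`, on which `s (y - μ) ≥ r` for a sign `s`
  obtain ⟨T, s, hs, hT, hTt, hT2, hTr⟩ : ∃ (T : Set ℝ) (s : ℝ), |s| = 1 ∧ MeasurableSet T ∧
      p.real T ≤ t ∧ t / 2 ≤ p.real T ∧ ∀ y ∈ T, r ≤ s * (y - μ) := by
    rcases le_total (p.real {y | y < μ - r}) (p.real {y | μ + r < y}) with h | h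
    · refine ⟨{y | μ + r < y}, 1, by simp, measurableSet_lt measurable_const measurable_id, ?_,
        by linarith, fun y hy => ?_⟩
      · rw [← hcompl]
        refine measureReal_mono fun y hy => ?_
        rw [mem_compl_iff, centered, mem_Icc, not_and_or, not_le, not_le]
        exact Or.inr hy
      · have : μ + r < y := hy
        linarith
    · refine ⟨{y | y < μ - r}, -1, by simp, measurableSet_lt measurable_id measurable_const, ?_,
        by linarith, fun y hy => ?_⟩
      · rw [← hcompl]
        refine measureReal_mono fun y hy => ?_
        rw [mem_compl_iff, centered, mem_Icc, not_and_or, not_le, not_le]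
        exact Or.inl hy
      · have : y < μ - r := hy
        linarith
  set P := p.real T with hP
  have hP0 : 0 ≤ P := measureReal_nonneg
  have hP1 : P ≤ 1 := by linarith
  have hind : Integrable (T.indicator fun _ => (1 : ℝ)) p := (integrable_const 1).indicator hT
  have hind' : ∫ y, T.indicator (fun _ => (1 : ℝ)) y ∂p = P := by
    rw [integral_indicator hT, setIntegral_const, smul_eq_mul, mul_one]
  have hY : Integrable (fun y => y - μ) p := hp.2.2.sub (integrable_const _)
  have hY0 : ∫ y, (y - μ) ∂p = 0 := by
    rw [integral_sub hp.2.2 (integrable_const _), hμ, mean]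
    simp
  refine ⟨fun y => T.indicator (fun _ => 1) y - P, ⟨?_, ?_, ?_⟩, ?_, ?_⟩
  · exact (measurable_const.indicator hT).sub measurable_const
  · intro y
    by_cases hy : y ∈ T <;> simp [hy, abs_le] <;> constructor <;> linarith
  · rw [integral_sub hind (integrable_const _), hind']
    simp
  · have e : ∀ y, (T.indicator (fun _ => (1 : ℝ)) y - P) ^ 2
        = (1 - 2 * P) * T.indicator (fun _ => (1 : ℝ)) y + P ^ 2 := by
      intro y
      by_cases hy : y ∈ T
      · simp [hy]
        ring
      · simp [hy]
    rw [integral_congr_ae (Filter.Eventually.of_forall e),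
      integral_add (hind.const_mul _) (integrable_const _), integral_const_mul, hind']
    simp
    nlinarith
  · have e : ∀ y, (T.indicator (fun _ => (1 : ℝ)) y - P) * y
        = T.indicator (fun y => y - μ) y - P * (y - μ)
          + μ * (T.indicator (fun _ => (1 : ℝ)) y - P) := by
      intro y
      by_cases hy : y ∈ T <;> simp [hy] <;> ring
    have i1 : Integrable (fun y => T.indicator (fun y => y - μ) y - P * (y - μ)) p :=
      (hY.indicator hT).sub (hY.const_mul _)
    have i2 : Integrable (fun y => μ * (T.indicator (fun _ => (1 : ℝ)) y - P)) p :=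
      (hind.sub (integrable_const _)).const_mul _
    rw [integral_congr_ae (Filter.Eventually.of_forall e),
      integral_add i1 i2,
      integral_sub (hY.indicator hT) (hY.const_mul _), integral_const_mul, integral_const_mul,
      integral_sub hind (integrable_const _), hind', hY0, integral_indicator hT]
    have h2 : P * r ≤ ∫ y in T, s * (y - μ) ∂p := by
      rw [mul_comm, hP]
      exact setIntegral_ge_of_const_le_real hT (measure_ne_top _ _) hTr
        (hY.const_mul _).integrableOn
    rw [integral_const_mul] at h2
    have h3 := le_abs_self (s * ∫ y in T, (y - μ) ∂p)
    rw [abs_mul, hs, one_mul] at h3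
    simp only [mul_zero, sub_zero, integral_const, probReal_univ, one_smul, sub_self, add_zero]
    nlinarith

end Directions

/-! ### The error function of a tilt -/

/-- The error function in terms of the ratio `x = log (1/δ) / m`, the only way in which it depends
on `m` and `δ`. -/
noncomputable def errAt (x : ℝ) (p : Measure ℝ) : ℝ :=
  |mean p - mean (trimmed p (0.45 * x))| + stdDev (trimmed p (0.45 * x)) * Real.sqrt (4.5 * x)

theorem errFn_eq_errAt (m δ : ℝ) (p : P1) : errFn m δ p = errAt (Real.log (1 / δ) / m) p.1 := by
  rw [errFn, pStar, errAt, show 0.45 / m * Real.log (1 / δ) = 0.45 * (Real.log (1 / δ) / m) by ring,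
    mul_div_assoc]

theorem errFn_div_three (n δ : ℝ) (p : P1) :
    errFn (n / 3) δ p = errAt (3 * (Real.log (1 / δ) / n)) p.1 := by
  rw [errFn_eq_errAt]
  congr 1
  rw [div_div_eq_mul_div]
  ring

theorem errAt_nonneg (x : ℝ) (p : Measure ℝ) : 0 ≤ errAt x p :=
  add_nonneg (abs_nonneg _) (mul_nonneg (stdDev_nonneg _) (Real.sqrt_nonneg _))

section ErrorOfTilt

variable {p : Measure ℝ} {φ : ℝ → ℝ} {x : ℝ}

theorem sqrt_four_half_mul_le (hx : 0 ≤ x) : Real.sqrt (4.5 * x) ≤ 2.2 * Real.sqrt x := by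
  rw [Real.sqrt_le_left (by positivity), mul_pow, Real.sq_sqrt hx]
  nlinarith

/-- Some direction of size `O(x)` in `χ²` moves the mean by a constant fraction of the error
function. If the bias of trimming dominates, trimming itself does. Otherwise the deviation term
`σ √x` dominates, and one uses a linear direction if the trimming radius is at most `σ / √x`, and
else the mass `≈ x` beyond the trimming radius. -/
theorem exists_direction_ge (hp : FiniteMean p) (hx0 : 0 < x) (hx : x ≤ 1 / 1000) :
    ∃ φ, IsDirection p φ ∧ ∫ y, φ y ^ 2 ∂p ≤ x / 2 ∧ errAt x p / 25 ≤ |∫ y, φ y * y ∂p| := by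
  have h0 : 0 < 0.45 * x := by positivity
  have h1 : 0.45 * x < 1 := by linarith
  have h4 := sqrt_four_half_mul_le hx0.le
  have hsx := Real.sqrt_pos.2 hx0
  have hsq := Real.sq_sqrt hx0.le
  have hσ0 := stdDev_nonneg (trimmed p (0.45 * x))
  rw [errAt, abs_sub_comm]
  have hb0 := abs_nonneg (mean (trimmed p (0.45 * x)) - mean p)
  rcases le_or_gt (stdDev (trimmed p (0.45 * x)) * Real.sqrt (4.5 * x))
    |mean (trimmed p (0.45 * x)) - mean p| with hb | hb
  · obtain ⟨φ, hφ, h2, h3⟩ := exists_direction_bias hp h0 h1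
    refine ⟨φ, hφ, by linarith, ?_⟩
    rw [h3]
    nlinarith
  · set σ := stdDev (trimmed p (0.45 * x))
    have hσ : 0 < σ := by
      refine hσ0.lt_of_ne fun h => ?_
      rw [← h, zero_mul] at hb
      linarith
    have h5 : σ * Real.sqrt (4.5 * x) ≤ σ * (2.2 * Real.sqrt x) :=
      mul_le_mul_of_nonneg_left h4 hσ0
    have h6 : 0 < σ * Real.sqrt x := mul_pos hσ hsx
    rcases le_or_gt (trimRadius p (0.45 * x) * Real.sqrt x) σ with hr | hr
    · obtain ⟨φ, hφ, h2, h3⟩ := exists_direction_linear hp h0 h1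
        (a := Real.sqrt x / (2 * σ)) (by positivity) (by
          rw [div_mul_eq_mul_div, div_le_iff₀ (by positivity)]
          linarith)
      change _ ≤ _ * σ ^ 2 at h2
      change _ = _ * (_ * σ ^ 2) at h3
      refine ⟨φ, hφ, h2.trans ?_, ?_⟩
      · rw [div_pow, hsq, mul_pow, div_mul_eq_mul_div, div_le_iff₀ (by positivity)]
        nlinarith [mul_pos hx0 (pow_pos hσ 2)]
      · rw [h3, show Real.sqrt x / (2 * σ) * ((1 - 0.45 * x) * σ ^ 2)
          = (1 - 0.45 * x) / 2 * (σ * Real.sqrt x) by field_simp]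
        nlinarith
    · obtain ⟨φ, hφ, h2, h3⟩ := exists_direction_tail hp h0 h1
      refine ⟨φ, hφ, by linarith, le_trans ?_ h3⟩
      have h7 : σ * Real.sqrt x ≤ trimRadius p (0.45 * x) * x := by
        calc σ * Real.sqrt x ≤ trimRadius p (0.45 * x) * Real.sqrt x * Real.sqrt x := by gcongr
          _ = trimRadius p (0.45 * x) * x := by rw [mul_assoc, ← sq, hsq]
      linarith

/-- As `exists_direction_ge`, with the shift of the mean scaled down to at most the error
function. -/
theorem exists_direction (hp : FiniteMean p) (hx0 : 0 < x) (hx : x ≤ 1 / 1000) :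
    ∃ φ, IsDirection p φ ∧ ∫ y, φ y ^ 2 ∂p ≤ x / 2 ∧ errAt x p / 25 ≤ |∫ y, φ y * y ∂p| ∧
      |∫ y, φ y * y ∂p| ≤ errAt x p := by
  obtain ⟨φ, hφ, h2, h3⟩ := exists_direction_ge hp hx0 hx
  have he := errAt_nonneg x p
  rcases le_or_gt |∫ y, φ y * y ∂p| (errAt x p) with h | h
  · exact ⟨φ, hφ, h2, h3, h⟩
  set M := ∫ y, φ y * y ∂p
  have hM : 0 < |M| := he.trans_lt h
  set c := errAt x p / |M| with hc
  have hc0 : 0 ≤ c := by positivity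
  have hc1 : c ≤ 1 := (div_le_one hM).2 h.le
  have hcM : |∫ y, c * φ y * y ∂p| = errAt x p := by
    simp_rw [mul_assoc]
    rw [integral_const_mul, abs_mul, abs_of_nonneg hc0, hc, div_mul_cancel₀ _ hM.ne']
  refine ⟨fun y => c * φ y, ⟨hφ.measurable.const_mul c, fun y => ?_, ?_⟩, ?_, ?_, hcM.le⟩
  · rw [abs_mul, abs_of_nonneg hc0]
    exact mul_le_one₀ hc1 (abs_nonneg _) (hφ.abs_le_one y)
  · rw [integral_const_mul, hφ.integral_eq_zero, mul_zero]
  · simp_rw [mul_pow]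
    rw [integral_const_mul]
    have : 0 ≤ ∫ y, φ y ^ 2 ∂p := integral_nonneg fun _ => sq_nonneg _
    have : c ^ 2 ≤ 1 := pow_le_one₀ hc0 hc1
    nlinarith
  · rw [hcM]
    linarith

theorem mul_setIntegral_sq_le_errAt_sq (hp : FiniteMean p) (hx0 : 0 < x) (hx : x ≤ 1 / 1000) :
    x * ∫ y in centered p (trimRadius p (0.45 * x)), (y - mean p) ^ 2 ∂p ≤ errAt x p ^ 2 := by
  rw [setIntegral_sq_sub hp (by positivity) (by linarith), errAt,
    ← sq_abs (mean (trimmed p _) - mean p), abs_sub_comm]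
  have h1 := abs_nonneg (mean p - mean (trimmed p (0.45 * x)))
  have h2 := stdDev_nonneg (trimmed p (0.45 * x))
  set b := |mean p - mean (trimmed p (0.45 * x))|
  set σ := stdDev (trimmed p (0.45 * x))
  have h3 : (σ * Real.sqrt (4.5 * x)) ^ 2 = σ ^ 2 * (4.5 * x) := by
    rw [mul_pow, Real.sq_sqrt (by positivity)]
  have h4 : 0 ≤ b * (σ * Real.sqrt (4.5 * x)) := by positivity
  have h5 : x * ((1 - 0.45 * x) * (σ ^ 2 + b ^ 2)) ≤ x * (σ ^ 2 + b ^ 2) := by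
    refine mul_le_mul_of_nonneg_left ?_ hx0.le
    have : 0 ≤ 0.45 * x * (σ ^ 2 + b ^ 2) := by positivity
    linarith
  have h6 : x * b ^ 2 ≤ b ^ 2 := by nlinarith [sq_nonneg b]
  have h7 : 0 ≤ x * σ ^ 2 := by positivity
  nlinarith

/-- The trimming radius of a tilt at level `3x`. Since a tilt at most doubles masses, trimming it
at the triple level cuts away a mass of order `x` inside the trimming interval of `p`, whose
second moment limits how far out this can happen. -/
theorem mul_trimRadius_tilt_le (hp : FiniteMean p) (hφ : IsDirection p φ) (hx0 : 0 < x)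
    (hx : x ≤ 1 / 1000) (hΔ : |mean (tilt p φ) - mean p| ≤ errAt x p) :
    x * (trimRadius (tilt p φ) (0.45 * (3 * x)) + |mean (tilt p φ) - mean p|)
      ≤ 2.3 * errAt x p := by
  have := hp.isProbabilityMeasure
  have hq := finiteMean_tilt hp hφ
  have := hq.isProbabilityMeasure
  have hV := mul_setIntegral_sq_le_errAt_sq hp hx0 hx
  have hIc := measureReal_centered_compl hp (t := 0.45 * x) (by positivity) (by linarith)
  have hJc := measureReal_centered_compl hq (t := 0.45 * (3 * x)) (by positivity) (by linarith)
  have he := errAt_nonneg x p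
  set I := centered p (trimRadius p (0.45 * x)) with hI
  set r' := trimRadius (tilt p φ) (0.45 * (3 * x))
  set J := centered (tilt p φ) r' with hJ
  set Δ := |mean (tilt p φ) - mean p|
  have hIJ : 0.225 * x ≤ p.real (I \ J) := by
    have h1 : (tilt p φ).real Jᶜ ≤ (tilt p φ).real (I \ J) + (tilt p φ).real Iᶜ := by
      refine (measureReal_mono fun y hy => ?_).trans (measureReal_union_le _ _)
      by_cases hyI : y ∈ I
      · exact Or.inl ⟨hyI, hy⟩
      · exact Or.inr hyI
    have h2 := measureReal_tilt_le hp hφ (I \ J)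
    have h3 := measureReal_tilt_le hp hφ Iᶜ
    linarith
  have hkey : x * (r' - Δ) ≤ 2.2 * errAt x p := by
    rcases le_or_gt r' Δ with h | h
    · nlinarith
    have h1 : (r' - Δ) ^ 2 * p.real (I \ J) ≤ ∫ y in I \ J, (y - mean p) ^ 2 ∂p := by
      refine setIntegral_ge_of_const_le_real
        ((measurableSet_centered _ _).diff (measurableSet_centered _ _)) (measure_ne_top _ _)
        (fun y hy => ?_)
        ((integrableOn_centered (by fun_prop) _ _).mono_set sdiff_subset)
      have h2 : r' < |y - mean (tilt p φ)| := by
        have := hy.2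
        rwa [hJ, mem_centered, not_le] at this
      have h3 := abs_sub_le y (mean p) (mean (tilt p φ))
      rw [abs_sub_comm (mean p)] at h3
      rw [← sq_abs (y - mean p)]
      exact pow_le_pow_left₀ (by linarith) (by linarith) 2
    have h2 : ∫ y in I \ J, (y - mean p) ^ 2 ∂p ≤ ∫ y in I, (y - mean p) ^ 2 ∂p :=
      setIntegral_mono_set (integrableOn_centered (by fun_prop) _ _)
        (Filter.Eventually.of_forall fun _ => sq_nonneg _) sdiff_subset.eventuallyLE
    have h3 : (r' - Δ) ^ 2 * (0.225 * x) ≤ (r' - Δ) ^ 2 * p.real (I \ J) :=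
      mul_le_mul_of_nonneg_left hIJ (sq_nonneg _)
    refine abs_le_of_sq_le_sq' ?_ (by positivity) |>.2
    have h4 := mul_le_mul_of_nonneg_left (h3.trans (h1.trans h2)) hx0.le
    nlinarith
  nlinarith

theorem setIntegral_tilt_le (hp : FiniteMean p) (hφ : IsDirection p φ) {f : ℝ → ℝ} {s : Set ℝ}
    (hs : MeasurableSet s) (hf : IntegrableOn f s p) (hf0 : ∀ y, 0 ≤ f y) :
    ∫ y in s, f y ∂(tilt p φ) ≤ 2 * ∫ y in s, f y ∂p := by
  have := hp.isProbabilityMeasure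
  rw [setIntegral_tilt hφ f hs, ← integral_const_mul]
  refine integral_mono_of_nonneg
    (Filter.Eventually.of_forall fun y => mul_nonneg (hφ.one_add_nonneg y) (hf0 y))
    (hf.const_mul _) (Filter.Eventually.of_forall fun y => ?_)
  exact mul_le_mul_of_nonneg_right (hφ.one_add_le_two y) (hf0 y)

/-- The second moment of a tilt on its own trimming interval: inside the trimming interval of `p`
it is at most twice that of `p`, and outside the tilt has mass `O(x)` within the new radius. -/
theorem mul_setIntegral_sq_tilt_le (hp : FiniteMean p) (hφ : IsDirection p φ) (hx0 : 0 < x)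
    (hx : x ≤ 1 / 1000) (hΔ : |mean (tilt p φ) - mean p| ≤ errAt x p) :
    x * ∫ y in centered (tilt p φ) (trimRadius (tilt p φ) (0.45 * (3 * x))),
      (y - mean p) ^ 2 ∂(tilt p φ) ≤ 7 * errAt x p ^ 2 := by
  have := hp.isProbabilityMeasure
  have hq := finiteMean_tilt hp hφ
  have := hq.isProbabilityMeasure
  have hV := mul_setIntegral_sq_le_errAt_sq hp hx0 hx
  have hR := mul_trimRadius_tilt_le hp hφ hx0 hx hΔ
  have hIc := measureReal_centered_compl hp (t := 0.45 * x) (by positivity) (by linarith)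
  have hr0 := (isTrimRadius_trimRadius hq (t := 0.45 * (3 * x)) (by positivity) (by linarith)).1
  set I := centered p (trimRadius p (0.45 * x)) with hI
  set r' := trimRadius (tilt p φ) (0.45 * (3 * x))
  set J := centered (tilt p φ) r' with hJ
  have hΔ0 := abs_nonneg (mean (tilt p φ) - mean p)
  set R := r' + |mean (tilt p φ) - mean p| with hRdef
  have hIm : MeasurableSet I := measurableSet_centered _ _
  have hJm : MeasurableSet J := measurableSet_centered _ _
  have hiI : IntegrableOn (fun y => (y - mean p) ^ 2) I (tilt p φ) :=
    integrableOn_centered (by fun_prop) _ _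
  have hiJ : IntegrableOn (fun y => (y - mean p) ^ 2) J (tilt p φ) :=
    integrableOn_centered (by fun_prop) _ _
  rw [← integral_inter_add_sdiff hIm hiJ]
  have h1 : ∫ y in J ∩ I, (y - mean p) ^ 2 ∂(tilt p φ)
      ≤ 2 * ∫ y in I, (y - mean p) ^ 2 ∂p :=
    (setIntegral_mono_set hiI (Filter.Eventually.of_forall fun _ => sq_nonneg _)
      inter_subset_right.eventuallyLE).trans
      (setIntegral_tilt_le hp hφ hIm (integrableOn_centered (by fun_prop) _ _)
        fun _ => sq_nonneg _)
  have h2 : ∫ y in J \ I, (y - mean p) ^ 2 ∂(tilt p φ) ≤ R ^ 2 * (tilt p φ).real (J \ I) := by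
    have := setIntegral_mono_on (μ := tilt p φ) (hiJ.mono_set sdiff_subset)
      (integrableOn_const (C := R ^ 2) (measure_ne_top _ _)) (hJm.diff hIm) (fun y hy => by
        have h3 := mem_centered.1 hy.1
        have h4 := abs_sub_le y (mean (tilt p φ)) (mean p)
        rw [← sq_abs]
        exact pow_le_pow_left₀ (abs_nonneg _) (by linarith) 2)
    rwa [setIntegral_const, smul_eq_mul, mul_comm] at this
  have h3 : (tilt p φ).real (J \ I) ≤ 0.9 * x := by
    have h4 := measureReal_tilt_le hp hφ Iᶜ
    have h5 : (tilt p φ).real (J \ I) ≤ (tilt p φ).real Iᶜ := measureReal_mono fun y hy => hy.2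
    linarith
  have h4 : x * (R ^ 2 * (tilt p φ).real (J \ I)) ≤ 0.9 * (x * R) ^ 2 := by
    have := mul_le_mul_of_nonneg_left h3 (by positivity : 0 ≤ x * R ^ 2)
    linarith
  have h5 : (x * R) ^ 2 ≤ (2.3 * errAt x p) ^ 2 := pow_le_pow_left₀ (by positivity) hR 2
  have h6 := mul_le_mul_of_nonneg_left h1 hx0.le
  have h7 := mul_le_mul_of_nonneg_left h2 hx0.le
  nlinarith

/-- The first moment of a tilt on its trimming interval `J`, compared with that of `p` on its
trimming interval `I`. The two differ by the tilt inside `I` and by contributions of `I \ J` and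
`J \ I`, all of which have mass `O(x)`. -/
theorem abs_setIntegral_tilt_le (hp : FiniteMean p) (hφ : IsDirection p φ) (hx0 : 0 < x)
    (hx : x ≤ 1 / 1000) (he : 0 < errAt x p) (hφ2 : ∫ y, φ y ^ 2 ∂p ≤ x / 2)
    (hΔ : |mean (tilt p φ) - mean p| ≤ errAt x p) :
    |∫ y in centered (tilt p φ) (trimRadius (tilt p φ) (0.45 * (3 * x))),
      (y - mean p) ∂(tilt p φ)| ≤ 6 * errAt x p := by
  have := hp.isProbabilityMeasure
  have hq := finiteMean_tilt hp hφ
  have := hq.isProbabilityMeasure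
  have hV := mul_setIntegral_sq_le_errAt_sq hp hx0 hx
  have hR := mul_trimRadius_tilt_le hp hφ hx0 hx hΔ
  have hIc := measureReal_centered_compl hp (t := 0.45 * x) (by positivity) (by linarith)
  have hJc := measureReal_centered_compl hq (t := 0.45 * (3 * x)) (by positivity) (by linarith)
  have hr0 := (isTrimRadius_trimRadius hq (t := 0.45 * (3 * x)) (by positivity) (by linarith)).1
  have hA1 := setIntegral_sub_mean_trimmed hp (t := 0.45 * x) (by positivity) (by linarith)
    (mean p)
  have hb : |mean (trimmed p (0.45 * x)) - mean p| ≤ errAt x p := by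
    rw [errAt, abs_sub_comm]
    exact le_add_of_nonneg_right (mul_nonneg (stdDev_nonneg _) (Real.sqrt_nonneg _))
  set ε := errAt x p
  set I := centered p (trimRadius p (0.45 * x)) with hI
  set r' := trimRadius (tilt p φ) (0.45 * (3 * x))
  set J := centered (tilt p φ) r' with hJ
  have hΔ0 := abs_nonneg (mean (tilt p φ) - mean p)
  set R := r' + |mean (tilt p φ) - mean p| with hRdef
  set V := ∫ y in I, (y - mean p) ^ 2 ∂p
  have hV0 : 0 ≤ V := setIntegral_sq_sub_nonneg _ _
  have hVe : x / ε * V ≤ ε := by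
    rw [div_mul_eq_mul_div, div_le_iff₀ he]
    linarith
  have hIm : MeasurableSet I := measurableSet_centered _ _
  have hJm : MeasurableSet J := measurableSet_centered _ _
  have hiI : IntegrableOn (fun y => y - mean p) I (tilt p φ) :=
    integrableOn_centered (by fun_prop) _ _
  have hiJ : IntegrableOn (fun y => y - mean p) J (tilt p φ) :=
    integrableOn_centered (by fun_prop) _ _
  have hiIp : IntegrableOn (fun y => y - mean p) I p := integrableOn_centered (by fun_prop) _ _
  have hsqI : IntegrableOn (fun y => (y - mean p) ^ 2) I p :=
    integrableOn_centered (by fun_prop) _ _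
  have hsqIq : IntegrableOn (fun y => (y - mean p) ^ 2) I (tilt p φ) :=
    integrableOn_centered (by fun_prop) _ _
  -- the weights match `V ≤ ε² / x` against masses of order `x`
  have amgm : ∀ u v : ℝ, |v * u| ≤ 1 / 2 * (x / ε * u ^ 2) + 1 / 2 * (ε / x * v ^ 2) := by
    intro u v
    have h1 : 1 / 2 * (x / ε * u ^ 2) + 1 / 2 * (ε / x * v ^ 2) - |v * u|
        = (x * |u| - ε * |v|) ^ 2 / (2 * ε * x) := by
      rw [abs_mul, ← sq_abs u, ← sq_abs v]
      field_simp
      ring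
    have h2 : 0 ≤ (x * |u| - ε * |v|) ^ 2 / (2 * ε * x) := by positivity
    linarith
  -- the integral over `J` is that over `I`, corrected on the two set differences
  have hsplit : ∫ y in J, (y - mean p) ∂(tilt p φ)
      = (∫ y in I, (y - mean p) ∂p) + (∫ y in I, φ y * (y - mean p) ∂p)
        - (∫ y in I \ J, (y - mean p) ∂(tilt p φ)) + ∫ y in J \ I, (y - mean p) ∂(tilt p φ) := by
    have h1 := integral_inter_add_sdiff hIm hiJ
    have h2 := integral_inter_add_sdiff hJm hiI
    have h3 : ∫ y in I, (y - mean p) ∂(tilt p φ)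
        = (∫ y in I, (y - mean p) ∂p) + ∫ y in I, φ y * (y - mean p) ∂p := by
      rw [setIntegral_tilt hφ _ hIm]
      simp_rw [add_mul, one_mul]
      exact integral_add hiIp
        (hiIp.bdd_mul (c := 1) hφ.measurable.aestronglyMeasurable
          (Filter.Eventually.of_forall hφ.abs_le_one))
    rw [inter_comm] at h2
    linarith
  have hB1 : |∫ y in I, (y - mean p) ∂p| ≤ ε := by
    rw [hA1, abs_mul, abs_of_pos (by linarith)]
    nlinarith [abs_nonneg (mean (trimmed p (0.45 * x)) - mean p)]
  have hB2 : |∫ y in I, φ y * (y - mean p) ∂p| ≤ 3 / 4 * ε := by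
    have h1 : ‖∫ y in I, φ y * (y - mean p) ∂p‖
        ≤ ∫ y in I, (1 / 2 * (x / ε * (y - mean p) ^ 2) + 1 / 2 * (ε / x * φ y ^ 2)) ∂p :=
      norm_integral_le_of_norm_le (((hsqI.const_mul _).const_mul _).add
        ((hφ.integrable_sq.integrableOn.const_mul _).const_mul _))
        (Filter.Eventually.of_forall fun y => amgm _ _)
    rw [integral_add ((hsqI.const_mul _).const_mul _)
        ((hφ.integrable_sq.integrableOn.const_mul _).const_mul _), integral_const_mul,
      integral_const_mul, integral_const_mul, integral_const_mul] at h1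
    have h2 : ∫ y in I, φ y ^ 2 ∂p ≤ x / 2 :=
      (setIntegral_le_integral hφ.integrable_sq
        (Filter.Eventually.of_forall fun _ => sq_nonneg _)).trans hφ2
    have h3 : ε / x * ∫ y in I, φ y ^ 2 ∂p ≤ ε / 2 := by
      refine (mul_le_mul_of_nonneg_left h2 (by positivity)).trans (le_of_eq ?_)
      field_simp
    rw [Real.norm_eq_abs] at h1
    linarith
  have hB3 : |∫ y in I \ J, (y - mean p) ∂(tilt p φ)| ≤ 1.7 * ε := by
    have hs := hsqIq.mono_set (sdiff_subset (s := I) (t := J))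
    have h1 : ‖∫ y in I \ J, (y - mean p) ∂(tilt p φ)‖
        ≤ ∫ y in I \ J, (1 / 2 * (x / ε * (y - mean p) ^ 2) + 1 / 2 * (ε / x * 1 ^ 2))
          ∂(tilt p φ) :=
      norm_integral_le_of_norm_le (((hs.const_mul _).const_mul _).add (integrable_const _))
        (Filter.Eventually.of_forall fun y => by simpa using amgm (y - mean p) 1)
    rw [integral_add ((hs.const_mul _).const_mul _) (integrable_const _), integral_const_mul,
      integral_const_mul, setIntegral_const, smul_eq_mul] at h1
    have h2 : ∫ y in I \ J, (y - mean p) ^ 2 ∂(tilt p φ) ≤ 2 * V :=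
      (setIntegral_mono_set hsqIq (Filter.Eventually.of_forall fun _ => sq_nonneg _)
        sdiff_subset.eventuallyLE).trans (setIntegral_tilt_le hp hφ hIm hsqI fun _ => sq_nonneg _)
    have h3 : (tilt p φ).real (I \ J) ≤ 0.45 * (3 * x) := by
      rw [← hJc]
      exact measureReal_mono fun y hy => hy.2
    have h4 : (tilt p φ).real (I \ J) * (1 / 2 * (ε / x * 1 ^ 2))
        ≤ 0.45 * (3 * x) * (1 / 2 * (ε / x * 1 ^ 2)) :=
      mul_le_mul_of_nonneg_right h3 (by positivity)
    have h5 : 0.45 * (3 * x) * (1 / 2 * (ε / x * 1 ^ 2)) = 0.675 * ε := by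
      field_simp
      ring
    have h6 : x / ε * ∫ y in I \ J, (y - mean p) ^ 2 ∂(tilt p φ) ≤ x / ε * (2 * V) :=
      mul_le_mul_of_nonneg_left h2 (by positivity)
    rw [Real.norm_eq_abs] at h1
    linarith
  have hB4 : |∫ y in J \ I, (y - mean p) ∂(tilt p φ)| ≤ 2.1 * ε := by
    have h1 : ‖∫ y in J \ I, (y - mean p) ∂(tilt p φ)‖ ≤ R * (tilt p φ).real (J \ I) :=
      norm_setIntegral_le_of_norm_le_const (measure_lt_top _ _) fun y hy => by
        have h3 := mem_centered.1 hy.1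
        have h4 := abs_sub_le y (mean (tilt p φ)) (mean p)
        rw [Real.norm_eq_abs]
        linarith
    have h3 : (tilt p φ).real (J \ I) ≤ 0.9 * x := by
      have h4 := measureReal_tilt_le hp hφ Iᶜ
      have h5 : (tilt p φ).real (J \ I) ≤ (tilt p φ).real Iᶜ := measureReal_mono fun y hy => hy.2
      linarith
    have h4 := mul_le_mul_of_nonneg_left h3 (by positivity : 0 ≤ R)
    rw [Real.norm_eq_abs] at h1
    linarith
  rw [hsplit, abs_le]
  rw [abs_le] at hB1 hB2 hB3 hB4
  constructor <;> linarith [hB1.1, hB1.2, hB2.1, hB2.2, hB3.1, hB3.2, hB4.1, hB4.2]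

/-- Tilts in directions of size `O(x)` in `χ²` that move the mean by at most the error function
do not have a much larger error function, even at a third of the sample size. -/
theorem errAt_tilt_le (hp : FiniteMean p) (hφ : IsDirection p φ) (hx0 : 0 < x)
    (hx : x ≤ 1 / 1000) (he : 0 < errAt x p) (hφ2 : ∫ y, φ y ^ 2 ∂p ≤ x / 2)
    (hΔ : |mean (tilt p φ) - mean p| ≤ errAt x p) :
    errAt (3 * x) (tilt p φ) ≤ 100 * errAt x p := by
  have hq := finiteMean_tilt hp hφ
  have h1 := abs_setIntegral_tilt_le hp hφ hx0 hx he hφ2 hΔ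
  have h2 := mul_setIntegral_sq_tilt_le hp hφ hx0 hx hΔ
  rw [setIntegral_sub_mean_trimmed hq (by positivity) (by linarith), abs_mul,
    abs_of_pos (by linarith)] at h1
  rw [setIntegral_sq_sub hq (by positivity) (by linarith)] at h2
  rw [errAt]
  have hσ0 := stdDev_nonneg (trimmed (tilt p φ) (0.45 * (3 * x)))
  set σ := stdDev (trimmed (tilt p φ) (0.45 * (3 * x)))
  set m := mean (trimmed (tilt p φ) (0.45 * (3 * x)))
  set ε := errAt x p
  have h3 : |m - mean p| ≤ 7 * ε := by nlinarith [abs_nonneg (m - mean p)]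
  have h4 : |mean (tilt p φ) - m| ≤ 8 * ε := by
    have := abs_sub_le (mean (tilt p φ)) (mean p) m
    rw [abs_sub_comm (mean p) m] at this
    linarith
  have h5 : σ * Real.sqrt (4.5 * (3 * x)) ≤ 10 * ε := by
    refine abs_le_of_sq_le_sq' ?_ (by positivity) |>.2
    rw [mul_pow, Real.sq_sqrt (by positivity)]
    have h6 : x * ((1 - 0.45 * (3 * x)) * σ ^ 2)
        ≤ x * ((1 - 0.45 * (3 * x)) * (σ ^ 2 + (m - mean p) ^ 2)) := by
      refine mul_le_mul_of_nonneg_left (mul_le_mul_of_nonneg_left ?_ ?_) hx0.le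
      · linarith [sq_nonneg (m - mean p)]
      · linarith
    have h7 : x * (0.99 * σ ^ 2) ≤ x * ((1 - 0.45 * (3 * x)) * σ ^ 2) := by
      refine mul_le_mul_of_nonneg_left (mul_le_mul_of_nonneg_right ?_ (sq_nonneg _)) hx0.le
      linarith
    nlinarith [sq_nonneg ε]
  linarith

end ErrorOfTilt

/-! ### The neighborhood Pareto bound -/

theorem six_le_log_one_div {δ : ℝ} (hδ0 : 0 < δ) (hδ : δ ≤ 1 / 1000) : 6 ≤ Real.log (1 / δ) := by
  rw [Real.le_log_iff_exp_le (by positivity), le_div_iff₀ hδ0]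
  have h1 : Real.exp 6 = Real.exp 1 ^ 6 := by rw [← Real.exp_nat_mul]; norm_num
  have h2 : Real.exp 1 ^ 6 ≤ 2.72 ^ 6 :=
    pow_le_pow_left₀ (Real.exp_pos 1).le (by linarith [Real.exp_one_lt_d9]) 6
  have h3 : Real.exp 6 ≤ 1000 := by rw [h1]; exact h2.trans (by norm_num)
  nlinarith

theorem log_le_log_one_sub_hellingerSq {n : ℕ} {δ h : ℝ} (hn : 0 < n) (hδ0 : 0 < δ)
    (hδ : δ ≤ 1 / 1000) (hx : Real.log (1 / δ) / n ≤ 1 / 1000) (h0 : 0 ≤ h)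
    (hh : h ≤ Real.log (1 / δ) / n / 4) :
    1 / (2 * (n : ℝ)) * Real.log (4 * δ) ≤ Real.log (1 - h) := by
  have hL := six_le_log_one_div hδ0 hδ
  have hn' : (0 : ℝ) < n := Nat.cast_pos.2 hn
  have h1 : 0 < 1 - h := by linarith
  have h2 := Real.one_sub_inv_le_log_of_pos h1
  have h3 : -(Real.log (1 / δ) / n / 3) ≤ 1 - (1 - h)⁻¹ := by
    have h4 : (1 - h)⁻¹ ≤ 1 + 4 / 3 * h := by
      rw [inv_le_iff_one_le_mul₀ h1]
      nlinarith
    linarith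
  refine le_trans ?_ (h3.trans h2)
  have h5 : Real.log (4 * δ) = 2 * Real.log 2 - Real.log (1 / δ) := by
    rw [Real.log_mul (by norm_num) hδ0.ne', one_div, Real.log_inv,
      show (4 : ℝ) = 2 ^ 2 by norm_num, Real.log_pow]
    push_cast
    ring
  rw [h5]
  have h6 := Real.log_two_lt_d9
  rw [← sub_nonneg, show -(Real.log (1 / δ) / n / 3)
    - 1 / (2 * (n : ℝ)) * (2 * Real.log 2 - Real.log (1 / δ))
    = (Real.log (1 / δ) / 6 - Real.log 2) / n by field_simp; ring]
  exact div_nonneg (by linarith) hn'.le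

theorem hellingerSq_nonneg (p q : Measure ℝ) : 0 ≤ hellingerSq p q :=
  mul_nonneg (by norm_num) (integral_nonneg fun _ => sq_nonneg _)

/-- Every distribution with a positive error function has a tilt in its neighborhood whose mean
differs by a constant fraction of the error function. -/
theorem exists_tilt_mem_nbhd {n : ℕ} {δ : ℝ} (hn : 0 < n) (hδ0 : 0 < δ) (hδ : δ ≤ 1 / 1000)
    (hx : Real.log (1 / δ) / n ≤ 1 / 1000) (P : P1) (he : 0 < errFn n δ P) :
    ∃ φ, IsDirection P.1 φ ∧ ∃ Q ∈ nbhd n δ P, Q.1 = tilt P.1 φ ∧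
      errFn n δ P / 25 ≤ |mean Q.1 - mean P.1| := by
  have hL := six_le_log_one_div hδ0 hδ
  have hn' : (0 : ℝ) < n := Nat.cast_pos.2 hn
  have hx0 : 0 < Real.log (1 / δ) / n := by positivity
  rw [errFn_eq_errAt] at he
  obtain ⟨φ, hφ, h2, h3, h4⟩ := exists_direction P.2 hx0 hx
  rw [← mean_tilt_sub_mean P.2 hφ] at h3 h4
  have hH := hellingerSq_tilt_le P.2 hφ
  refine ⟨φ, hφ, ⟨tilt P.1 φ, finiteMean_tilt P.2 hφ⟩, ⟨?_, ⟨?_, ?_⟩, ?_, ?_, ?_⟩, rfl, ?_⟩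
  · rw [errFn_div_three, errFn_eq_errAt]
    exact errAt_tilt_le P.2 hφ hx0 hx he h2 h4
  · change hellingerSq P.1 (tilt P.1 φ) < 1
    linarith
  · exact log_le_log_one_sub_hellingerSq hn hδ0 hδ hx (hellingerSq_nonneg _ _)
      (by change hellingerSq P.1 (tilt P.1 φ) ≤ _; linarith)
  · rw [errFn_eq_errAt]
    exact h4
  · exact tilt_absolutelyContinuous
  · exact rnDeriv_tilt_le P.2 hφ
  · rw [errFn_eq_errAt]
    exact h3

theorem isParetoBound_min_errFn {n : ℕ} {δ κ : ℝ} (hn : 0 < n) (hδ0 : 0 < δ) (hδ : δ ≤ 1 / 1000)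
    (hx : Real.log (1 / δ) / n ≤ 1 / 1000) (hκ : 2525 ≤ κ) :
    IsParetoBound n δ (nbhd n δ)
      (fun p => 1 / κ * min (errFn ((n : ℝ) / 3) δ p) (errFn n δ p)) := by
  have hκ0 : 0 < κ := by linarith
  refine ⟨fun p => mul_nonneg (by positivity) (le_min (errFn_nonneg _ _ _) (errFn_nonneg _ _ _)),
    ?_⟩
  rintro P ⟨μhat, hμ, hN, hP⟩
  rcases (errFn_nonneg n δ P).eq_or_lt with he | he
  · -- if the error function vanishes, the strict bound at `P` is the empty event
    have h1 : {x | |μhat x - mean P.1| < 1 / κ * min (errFn ((n : ℝ) / 3) δ P) (errFn n δ P)}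
        = ∅ := by
      rw [← he, min_eq_right (errFn_nonneg _ _ _), mul_zero]
      exact eq_empty_of_forall_notMem fun x (hx : |μhat x - mean P.1| < 0) =>
        (abs_nonneg _).not_gt hx
    rw [ErrorLT, h1, measureReal_empty] at hP
    linarith
  · obtain ⟨φ, hφ, Q, hQN, hQ, hshift⟩ := exists_tilt_mem_nbhd hn hδ0 hδ hx P he
    refine not_errorLT_of_errorLE_tilt hφ hQ hδ0 (by linarith) hn hQN.2.1.1 hQN.2.1.2 hμ
      ?_ (hN Q hQN) hP
    refine le_trans ?_ hshift
    have h1 : min (errFn ((n : ℝ) / 3) δ Q) (errFn n δ Q) ≤ 100 * errFn n δ P :=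
      (min_le_left _ _).trans hQN.1
    have h2 : min (errFn ((n : ℝ) / 3) δ P) (errFn n δ P) ≤ errFn n δ P := min_le_right _ _
    rw [← mul_add]
    calc 1 / κ * (min (errFn ((n : ℝ) / 3) δ Q) (errFn n δ Q)
          + min (errFn ((n : ℝ) / 3) δ P) (errFn n δ P))
        ≤ 1 / 2525 * (100 * errFn n δ P + errFn n δ P) := by
          refine mul_le_mul (one_div_le_one_div_of_le (by norm_num) hκ) (add_le_add h1 h2)
            (add_nonneg ?_ ?_) (by norm_num) <;>
          exact le_min (errFn_nonneg _ _ _) (errFn_nonneg _ _ _)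
      _ = errFn n δ P / 25 := by ring

/-! ### Order statistics and the median -/

section Median

variable {k : ℕ}

theorem card_filter_comp_sort (v : Fin k → ℝ) (r : ℝ → Prop) [DecidablePred r] :
    (Finset.univ.filter fun i => r ((v ∘ Tuple.sort v) i)).card
      = (Finset.univ.filter fun i => r (v i)).card := by
  refine Finset.card_bij (fun i _ => Tuple.sort v i) (by simp)
    (fun _ _ _ _ h => (Tuple.sort v).injective h) fun j hj => ?_
  exact ⟨(Tuple.sort v).symm j, by simpa using hj, by simp⟩

theorem apply_sort_le_iff (v : Fin k → ℝ) (j : Fin k) (a : ℝ) :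
    v (Tuple.sort v j) ≤ a ↔ j.val < (Finset.univ.filter fun i => v i ≤ a).card := by
  rw [← card_filter_comp_sort v (· ≤ a)]
  exact (Tuple.lt_card_le_iff_apply_le_of_monotone (Tuple.monotone_sort v)).symm

theorem apply_sort_lt_iff (v : Fin k → ℝ) (j : Fin k) (a : ℝ) :
    v (Tuple.sort v j) < a ↔ j.val < (Finset.univ.filter fun i => v i < a).card := by
  rw [← card_filter_comp_sort v (· < a)]
  exact (Tuple.lt_card_lt_iff_apply_lt_of_monotone (Tuple.monotone_sort v)).symm

theorem measurable_apply_sort (j : Fin k) :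
    Measurable fun v : Fin k → ℝ => v (Tuple.sort v j) := by
  refine measurable_of_Iic fun a => ?_
  have h : (fun v : Fin k → ℝ => v (Tuple.sort v j)) ⁻¹' Iic a
      = {v | j.val < ∑ i, if v i ≤ a then 1 else 0} := by
    ext v
    simp only [mem_preimage, mem_Iic, apply_sort_le_iff, Finset.card_filter]
    rfl
  rw [h]
  refine measurableSet_lt measurable_const (Finset.measurable_sum _ fun i _ => ?_)
  exact Measurable.ite (measurableSet_le (measurable_pi_apply i) measurable_const)
    measurable_const measurable_const

theorem measurable_median : Measurable (median : (Fin k → ℝ) → ℝ) := by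
  unfold median
  split_ifs with h
  · exact ((measurable_apply_sort _).add (measurable_apply_sort _)).div_const 2
  · exact measurable_const

/-- If the median is off by more than `s`, so is at least half of the values. -/
theorem le_two_mul_card_of_lt_abs_median_sub {v : Fin k → ℝ} {c s : ℝ}
    (h : s < |median v - c|) :
    k ≤ 2 * (Finset.univ.filter fun j => s < |v j - c|).card := by
  rcases Nat.eq_zero_or_pos k with hk | hk
  · omega
  rw [median, dif_pos hk] at h
  set i₁ : Fin k := ⟨(k - 1) / 2, by omega⟩ with hi₁
  set i₂ : Fin k := ⟨k / 2, by omega⟩ with hi₂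
  have hmono : v (Tuple.sort v i₁) ≤ v (Tuple.sort v i₂) :=
    Tuple.monotone_sort v (by rw [hi₁, hi₂, Fin.mk_le_mk]; omega)
  rcases lt_abs.1 h with h | h
  · have h1 : ¬ v (Tuple.sort v i₂) ≤ c + s := by
      rw [not_le]
      linarith
    rw [apply_sort_le_iff, not_lt] at h1
    have h2 := Finset.card_filter_add_card_filter_not (s := Finset.univ)
      (fun i : Fin k => v i ≤ c + s)
    rw [Finset.card_univ, Fintype.card_fin] at h2
    have h3 : (Finset.univ.filter fun i : Fin k => ¬ v i ≤ c + s).card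
        ≤ (Finset.univ.filter fun j => s < |v j - c|).card := by
      refine Finset.card_le_card (Finset.monotone_filter_right _ fun j _ hj => ?_)
      rw [not_le] at hj
      exact lt_abs.2 (Or.inl (by linarith))
    have h4 : i₂.val = k / 2 := rfl
    omega
  · have h1 : v (Tuple.sort v i₁) < c - s := by linarith
    rw [apply_sort_lt_iff] at h1
    have h3 : (Finset.univ.filter fun i : Fin k => v i < c - s).card
        ≤ (Finset.univ.filter fun j => s < |v j - c|).card := by
      refine Finset.card_le_card (Finset.monotone_filter_right _ fun j _ hj => ?_)
      exact lt_abs.2 (Or.inr (by linarith))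
    have h4 : i₁.val = (k - 1) / 2 := rfl
    omega

end Median

theorem measurable_medianOfMeans (n : ℕ) (δ : ℝ) : Measurable (medianOfMeans n δ) := by
  refine measurable_median.comp (measurable_pi_lambda _ fun j => ?_)
  exact (Finset.measurable_sum _ fun i _ => measurable_pi_apply i).div_const _

/-! ### Independent groups of coordinates -/

/-- Events that depend on the coordinates in disjoint groups (the fibers of `g`) are independent
under a product measure; this is the resulting bound on the probability that they all occur. -/
theorem measureReal_pi_biInter_le {ι κ : Type*} [Fintype ι] {p : Measure ℝ}
    [IsProbabilityMeasure p] (g : ι → κ) {B : κ → Set (ι → ℝ)} (hB : ∀ j, MeasurableSet (B j))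
    (hdep : ∀ j x y, (∀ i, g i = j → x i = y i) → x ∈ B j → y ∈ B j) {q : ℝ}
    (S : Finset κ) (hq : ∀ j ∈ S, (Measure.pi fun _ : ι => p).real (B j) ≤ q) :
    (Measure.pi fun _ : ι => p).real (⋂ j ∈ S, B j) ≤ q ^ S.card := by
  classical
  induction S using Finset.induction_on with
  | empty => simp
  | insert a S ha ih =>
    -- the tuple of the coordinates in `T`, extended by `0`
    let ext : (T : Finset ι) → (T → ℝ) → ι → ℝ := fun T z i => if h : i ∈ T then z ⟨i, h⟩ else 0
    have hext : ∀ T, Measurable (ext T) := by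
      intro T
      refine measurable_pi_lambda _ fun i => ?_
      by_cases h : i ∈ T
      · simpa [ext, h] using measurable_pi_apply _
      · simp [ext, h]
    let T₁ : Finset ι := Finset.univ.filter fun i => g i = a
    let T₂ : Finset ι := Finset.univ.filter fun i => g i ∈ S
    have hdisj : Disjoint T₁ T₂ := by
      rw [Finset.disjoint_left]
      intro i h1 h2
      simp only [T₁, T₂, Finset.mem_filter_univ] at h1 h2
      exact ha (h1 ▸ h2)
    have hiff : ∀ j T, (∀ i, g i = j → i ∈ T) → ∀ x : ι → ℝ,
        (ext T (fun i : T => x i) ∈ B j ↔ x ∈ B j) := by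
      intro j T hT x
      constructor <;> refine hdep j _ _ fun i hi => ?_ <;> simp [ext, hT i hi]
    have hind : iIndepFun (fun (i : ι) (x : ι → ℝ) => x i) (Measure.pi fun _ : ι => p) :=
      iIndepFun_pi (X := fun _ => id) fun _ => aemeasurable_id
    have h1 := (hind.indepFun_finset T₁ T₂ hdisj fun i => measurable_pi_apply i
      ).measure_inter_preimage_eq_mul (ext T₁ ⁻¹' B a) (ext T₂ ⁻¹' ⋂ j ∈ S, B j)
      (hext T₁ (hB a)) (hext T₂ (S.measurableSet_biInter fun j _ => hB j))
    have e1 : (fun (x : ι → ℝ) (i : T₁) => x i) ⁻¹' (ext T₁ ⁻¹' B a) = B a := by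
      ext x
      exact hiff a T₁ (fun i hi => by simp [T₁, hi]) x
    have e2 : (fun (x : ι → ℝ) (i : T₂) => x i) ⁻¹' (ext T₂ ⁻¹' ⋂ j ∈ S, B j)
        = ⋂ j ∈ S, B j := by
      ext x
      simp only [mem_preimage, mem_iInter]
      exact forall₂_congr fun j hj => hiff j T₂ (fun i hi => by simp [T₂, hi, hj]) x
    rw [e1, e2] at h1
    rw [Finset.set_biInter_insert, measureReal_def, h1, ENNReal.toReal_mul,
      Finset.card_insert_of_notMem ha, pow_succ']
    have hqa := hq a (Finset.mem_insert_self _ _)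
    exact mul_le_mul hqa (ih fun j hj => hq j (Finset.mem_insert_of_mem hj))
      ENNReal.toReal_nonneg (measureReal_nonneg.trans hqa)

/-- If `k` events satisfy the product bound with probability `0.16 = 0.4²` each, then at least half
of them occur with probability at most `2^k * 0.4^k`. -/
theorem measureReal_half_le {Ω : Type*} [MeasurableSpace Ω] {P : Measure Ω} [IsFiniteMeasure P]
    {k : ℕ} {B : Fin k → Set Ω}
    (hB : ∀ S : Finset (Fin k), P.real (⋂ j ∈ S, B j) ≤ 0.16 ^ S.card)
    {E : Set Ω} (hE : ∀ ω ∈ E, ∃ S : Finset (Fin k), k ≤ 2 * S.card ∧ ∀ j ∈ S, ω ∈ B j) :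
    P.real E ≤ 0.8 ^ k := by
  set F : Finset (Finset (Fin k)) := Finset.univ.filter fun S => k ≤ 2 * S.card with hF
  have h1 : E ⊆ ⋃ S ∈ F, ⋂ j ∈ S, B j := by
    intro ω hω
    obtain ⟨S, hS, h⟩ := hE ω hω
    simp only [mem_iUnion, mem_iInter]
    exact ⟨S, by simpa [hF] using hS, h⟩
  calc P.real E ≤ P.real (⋃ S ∈ F, ⋂ j ∈ S, B j) := measureReal_mono h1 (measure_ne_top _ _)
    _ ≤ ∑ S ∈ F, P.real (⋂ j ∈ S, B j) := measureReal_biUnion_finset_le _ _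
    _ ≤ ∑ S ∈ F, (0.4 : ℝ) ^ k := by
        refine Finset.sum_le_sum fun S hS => (hB S).trans ?_
        rw [show (0.16 : ℝ) = 0.4 ^ 2 by norm_num, ← pow_mul]
        exact pow_le_pow_of_le_one (by norm_num) (by norm_num) (Finset.mem_filter.1 hS).2
    _ = F.card * (0.4 : ℝ) ^ k := by rw [Finset.sum_const, nsmul_eq_mul]
    _ ≤ 2 ^ k * (0.4 : ℝ) ^ k := by
        refine mul_le_mul_of_nonneg_right ?_ (by positivity)
        have : F.card ≤ 2 ^ k := by
          simpa using Finset.card_le_univ F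
        exact_mod_cast this
    _ = 0.8 ^ k := by rw [← mul_pow]; norm_num

/-! ### The error of median-of-means -/

section GroupMean

variable {p : Measure ℝ} {x : ℝ}

theorem stdDev_trimmed_pos (hp : FiniteMean p) {t : ℝ} (h0 : 0 < t) (h1 : t < 1) :
    0 < stdDev (trimmed p t) := by
  have := hp.isProbabilityMeasure
  refine (stdDev_nonneg _).lt_of_ne fun h => ?_
  have h2 := setIntegral_sq_sub hp h0 h1 (mean (trimmed p t))
  rw [← h, sub_self] at h2
  have h3 : ∫ y in centered p (trimRadius p t), (y - mean (trimmed p t)) ^ 2 ∂p = 0 := by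
    rw [h2]
    ring
  rw [setIntegral_eq_zero_iff_of_nonneg_ae (Filter.Eventually.of_forall fun _ => sq_nonneg _)
    (integrableOn_centered (by fun_prop) _ _)] at h3
  -- the trimming interval would carry only the atom at the trimmed mean
  have h4 : ∀ᵐ y ∂p.restrict (centered p (trimRadius p t)), False := by
    have h5 : ∀ᵐ y ∂p, y ≠ mean (trimmed p t) := by
      rw [ae_iff]
      simpa using hp.2.1 _
    filter_upwards [h3, ae_restrict_of_ae h5] with y hy hy'
    exact hy' (sub_eq_zero.1 (pow_eq_zero_iff two_ne_zero |>.1 hy))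
  have h5 : p.real (centered p (trimRadius p t)) = 0 := by
    rw [Filter.eventually_false_iff_eq_bot, ae_eq_bot, Measure.restrict_eq_zero] at h4
    rw [measureReal_def, h4, ENNReal.toReal_zero]
  rw [(isTrimRadius_trimRadius hp h0 h1.le).2] at h5
  linarith

/-- The mean of a group of `b` samples is off by more than ten times the error function with
probability at most `0.16`: with probability at least `1 - 0.1` no sample of the group lies outside
the trimming interval, and for samples replaced there by the trimmed mean, Chebyshev's inequality
applies. -/
theorem measureReal_groupMean_le {n : ℕ} (hp : FiniteMean p) (hx0 : 0 < x) (hx : x ≤ 1 / 1000)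
    {T : Finset (Fin n)} (hT : 0 < T.card) (hT1 : 1 / 10 ≤ T.card * x)
    (hT2 : T.card * (0.45 * x) ≤ 0.1) :
    (Measure.pi fun _ : Fin n => p).real
      {ω | 10 * errAt x p < |(∑ i ∈ T, ω i) / T.card - mean p|} ≤ 0.16 := by
  have := hp.isProbabilityMeasure
  have h0 : 0 < 0.45 * x := by positivity
  have h1 : 0.45 * x < 1 := by linarith
  have hIc := measureReal_centered_compl hp h0 h1.le
  have hpI := (isTrimRadius_trimRadius hp h0 h1.le).2
  have hσ := stdDev_trimmed_pos hp h0 h1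
  have hV := setIntegral_sq_sub hp h0 h1 (mean (trimmed p (0.45 * x)))
  have hM := setIntegral_sub_mean_trimmed hp h0 h1 (mean (trimmed p (0.45 * x)))
  rw [sub_self] at hV hM
  rw [errAt]
  set I := centered p (trimRadius p (0.45 * x)) with hI
  set m := mean (trimmed p (0.45 * x))
  set σ := stdDev (trimmed p (0.45 * x))
  set b : ℝ := (T.card : ℝ) with hb
  have hb0 : 0 < b := Nat.cast_pos.2 hT
  have hIm : MeasurableSet I := measurableSet_centered _ _
  set P := Measure.pi fun _ : Fin n => p with hP
  -- the truncated deviation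
  set h : ℝ → ℝ := I.indicator fun y => y - m with hh
  have hhm : Measurable h := Measurable.indicator (by fun_prop) hIm
  have hh2 : MemLp h 2 p := by
    rw [hh, memLp_indicator_iff_restrict hIm]
    refine (memLp_two_iff_integrable_sq (by fun_prop)).2 ?_
    exact integrableOn_centered (by fun_prop) _ _
  have hh0 : ∫ y, h y ∂p = 0 := by
    rw [hh, integral_indicator hIm, hM, mul_zero]
  have hvar : variance h p ≤ σ ^ 2 := by
    rw [variance_of_integral_eq_zero hhm.aemeasurable hh0]
    have e : ∀ y, h y ^ 2 = I.indicator (fun y => (y - m) ^ 2) y := by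
      intro y
      by_cases hy : y ∈ I <;> simp [hh, hy]
    rw [integral_congr_ae (Filter.Eventually.of_forall e), integral_indicator hIm, hV]
    nlinarith [sq_nonneg σ]
  have hmp : ∀ i : Fin n, MeasurePreserving (fun ω : Fin n → ℝ => ω i) P p := fun i =>
    measurePreserving_eval (fun _ : Fin n => p) i
  have hmem : ∀ i : Fin n, MemLp (fun ω : Fin n → ℝ => h (ω i)) 2 P := fun i =>
    hh2.comp_measurePreserving (hmp i)
  have hint : ∀ i : Fin n, ∫ ω, h (ω i) ∂P = 0 := by
    intro i
    rw [← hh0, ← (hmp i).map_eq, integral_map (hmp i).measurable.aemeasurable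
      hhm.aestronglyMeasurable]
  have hvi : ∀ i : Fin n, variance (fun ω : Fin n → ℝ => h (ω i)) P = variance h p := by
    intro i
    rw [← (hmp i).map_eq, variance_map hhm.aemeasurable (hmp i).measurable.aemeasurable]
    rfl
  have hind : iIndepFun (fun (i : Fin n) (ω : Fin n → ℝ) => h (ω i)) P :=
    iIndepFun_pi (X := fun _ => h) fun _ => hhm.aemeasurable
  set S : (Fin n → ℝ) → ℝ := ∑ i ∈ T, fun ω => h (ω i) with hS
  have hSapp : ∀ ω, S ω = ∑ i ∈ T, h (ω i) := fun ω => by rw [hS, Finset.sum_apply]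
  have hSm : MemLp S 2 P := memLp_finsetSum' _ fun i _ => hmem i
  have hSv : variance S P ≤ b * σ ^ 2 := by
    rw [hS, IndepFun.variance_sum (fun i _ => hmem i)
      (fun i _ j _ hij => hind.indepFun hij)]
    simp_rw [hvi]
    rw [Finset.sum_const, nsmul_eq_mul]
    exact mul_le_mul_of_nonneg_left hvar hb0.le
  have hS0 : ∫ ω, S ω ∂P = 0 := by
    simp_rw [hSapp]
    rw [integral_finsetSum _ fun i _ => (hmem i).integrable one_le_two]
    exact Finset.sum_eq_zero fun i _ => hint i
  set s := 10 * (σ * Real.sqrt (4.5 * x)) with hs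
  have hs0 : 0 < s := by
    have : 0 < Real.sqrt (4.5 * x) := Real.sqrt_pos.2 (by positivity)
    positivity
  have hcheb : P.real {ω | b * s ≤ |S ω|} ≤ 0.06 := by
    have h2 := meas_ge_le_variance_div_sq hSm (mul_pos hb0 hs0)
    rw [hS0] at h2
    simp only [sub_zero] at h2
    have h3 := ENNReal.toReal_le_of_le_ofReal
      (div_nonneg (variance_nonneg _ _) (sq_nonneg _)) h2
    refine h3.trans ?_
    rw [div_le_iff₀ (by positivity)]
    have h4 : s ^ 2 = 450 * (σ ^ 2 * x) := by
      rw [hs, mul_pow, mul_pow, Real.sq_sqrt (by positivity)]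
      ring
    rw [mul_pow, h4]
    have h5 : b * σ ^ 2 * (1 / 10) ≤ b * σ ^ 2 * (b * x) :=
      mul_le_mul_of_nonneg_left hT1 (by positivity)
    have h6 : 0 < b * σ ^ 2 := by positivity
    linarith
  have hout : P.real (⋃ i ∈ T, (fun ω : Fin n → ℝ => ω i) ⁻¹' Iᶜ) ≤ 0.1 := by
    refine (measureReal_biUnion_finset_le _ _).trans ?_
    have e : ∀ i : Fin n, P.real ((fun ω : Fin n → ℝ => ω i) ⁻¹' Iᶜ) = 0.45 * x := by
      intro i
      rw [measureReal_def, (hmp i).measure_preimage hIm.compl.nullMeasurableSet,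
        ← measureReal_def, hIc]
    simp_rw [e]
    rwa [Finset.sum_const, nsmul_eq_mul]
  have hsub : {ω : Fin n → ℝ | 10 * (|mean p - m| + σ * Real.sqrt (4.5 * x))
      < |(∑ i ∈ T, ω i) / b - mean p|}
      ⊆ (⋃ i ∈ T, (fun ω : Fin n → ℝ => ω i) ⁻¹' Iᶜ) ∪ {ω | b * s ≤ |S ω|} := by
    intro ω hω
    by_contra hcon
    rw [mem_union, not_or] at hcon
    obtain ⟨hc1, hc2⟩ := hcon
    simp only [mem_iUnion, mem_preimage, mem_compl_iff, not_exists, not_not] at hc1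
    have hc3 : |S ω| < b * s := not_le.1 hc2
    have hω' : 10 * (|mean p - m| + σ * Real.sqrt (4.5 * x))
      < |(∑ i ∈ T, ω i) / b - mean p| := hω
    have e1 : S ω = ∑ i ∈ T, ω i - b * m := by
      rw [hSapp, Finset.sum_congr rfl fun i hi => indicator_of_mem (hc1 i hi) _,
        Finset.sum_sub_distrib, Finset.sum_const, nsmul_eq_mul]
    have e2 : (∑ i ∈ T, ω i) / b - m = S ω / b := by
      rw [e1]
      field_simp
    have h2 : |(∑ i ∈ T, ω i) / b - m| < s := by
      rw [e2, abs_div, abs_of_pos hb0, div_lt_iff₀ hb0]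
      linarith
    have h3 := abs_sub_le ((∑ i ∈ T, ω i) / b) m (mean p)
    rw [abs_sub_comm m] at h3
    linarith [abs_nonneg (mean p - m)]
  calc P.real _ ≤ _ := measureReal_mono hsub
    _ ≤ _ := measureReal_union_le _ _
    _ ≤ 0.16 := by linarith

end GroupMean

theorem card_filter_div_eq {n b k j : ℕ} (hb : 0 < b) (hkb : k * b ≤ n) (hj : j < k) :
    (Finset.univ.filter fun i : Fin n => i.val / b = j).card = b := by
  have h1 : (j + 1) * b ≤ n := (Nat.mul_le_mul_right b hj).trans hkb
  have h2 : ((Finset.univ.filter fun i : Fin n => i.val / b = j).map Fin.valEmbedding)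
      = Finset.Ico (j * b) ((j + 1) * b) := by
    ext i
    simp only [Finset.mem_map, Finset.mem_filter_univ, Fin.valEmbedding_apply, Finset.mem_Ico]
    have h3 := Nat.add_one_mul j b
    constructor
    · rintro ⟨i, hi, rfl⟩
      rw [Nat.div_eq_iff hb] at hi
      omega
    · intro hi
      have h4 : i / b = j := (Nat.div_eq_iff hb).2 (by omega)
      exact ⟨⟨i, by omega⟩, h4, rfl⟩
  rw [← Finset.card_map Fin.valEmbedding, h2, Nat.card_Ico, Nat.add_one_mul]
  omega

/-- With `k ≥ 4.5 log (1/δ)` groups, `0.8 ^ k` is at most `δ`, because `log (5/4) ≥ 2/9`. -/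
theorem pow_numGroups_le {δ : ℝ} (hδ0 : 0 < δ) : (0.8 : ℝ) ^ numGroups δ ≤ δ := by
  have h1 : 4.5 * Real.log (1 / δ) ≤ numGroups δ := Nat.le_ceil _
  have h2 : Real.log 0.8 ≤ -(2 / 9) := by
    rw [Real.log_le_iff_le_exp (by norm_num)]
    have h3 : Real.exp (-(2 / 9)) ^ 9 = (Real.exp 1 ^ 2)⁻¹ := by
      rw [← Real.exp_nat_mul, ← Real.exp_nat_mul, ← Real.exp_neg]
      norm_num
    refine le_of_pow_le_pow_left₀ (n := 9) (by norm_num) (Real.exp_pos _).le ?_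
    rw [h3, le_inv_comm₀ (by norm_num) (by positivity)]
    exact (pow_le_pow_left₀ (Real.exp_pos 1).le Real.exp_one_lt_d9.le 2).trans (by norm_num)
  rw [← Real.log_le_log_iff (by positivity) hδ0, Real.log_pow]
  have h4 : (numGroups δ : ℝ) * Real.log 0.8 ≤ numGroups δ * -(2 / 9) :=
    mul_le_mul_of_nonneg_left h2 (Nat.cast_nonneg _)
  rw [one_div, Real.log_inv] at h1
  linarith

/-- Median-of-means attains ten times the error function. The constant `0.45` in the trimming level
makes the expected number of trimmed samples in a group of at most `n / k` samples, with
`k ≥ 4.5 log (1/δ)`, at most `0.1`. -/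
theorem errorLE_medianOfMeans {n : ℕ} {δ : ℝ} (hn : 0 < n) (hδ0 : 0 < δ) (hδ : δ ≤ 1 / 1000)
    (hx : Real.log (1 / δ) / n ≤ 1 / 1000) (p : P1) {e : ℝ} (he : 10 * errFn n δ p ≤ e) :
    ErrorLE δ (medianOfMeans n δ) p e := by
  have := p.2.isProbabilityMeasure
  have hL := six_le_log_one_div hδ0 hδ
  have hn' : (0 : ℝ) < n := Nat.cast_pos.2 hn
  have hx0 : 0 < Real.log (1 / δ) / n := by positivity
  set k := numGroups δ with hk
  have hk1 : 4.5 * Real.log (1 / δ) ≤ k := Nat.le_ceil _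
  have hk2 : (k : ℝ) < 4.5 * Real.log (1 / δ) + 1 := Nat.ceil_lt_add_one (by positivity)
  have hLn : Real.log (1 / δ) ≤ n / 1000 := by
    rw [div_le_iff₀ hn'] at hx
    linarith
  have hkpos : 0 < k := by
    have : (0 : ℝ) < k := by linarith
    exact_mod_cast this
  have hkn : k ≤ n := by
    have : (k : ℝ) ≤ n := by linarith
    exact_mod_cast this
  set b := n / k with hb
  have hb0 : 0 < b := Nat.div_pos hkn hkpos
  have hkb : k * b ≤ n := Nat.mul_div_le n k
  have hkb' : (k : ℝ) * b ≤ n := by exact_mod_cast hkb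
  -- `b = ⌊n / k⌋ ≥ n / (2 k)`
  have hb2 : (n : ℝ) ≤ 2 * (k * b) := by
    have h1 : n < k * (b + 1) := Nat.lt_mul_div_succ n hkpos
    have h2 : k * 1 ≤ k * b := Nat.mul_le_mul_left k hb0
    have h3 : n ≤ 2 * (k * b) := by
      rw [mul_add] at h1
      omega
    exact_mod_cast h3
  have hbp : (0 : ℝ) < b := Nat.cast_pos.2 hb0
  let B : Fin k → Set (Fin n → ℝ) := fun j => {ω | 10 * errFn n δ p
    < |(∑ i : Fin n with i.val / b = j.val, ω i) / b - mean p.1|}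
  have hBm : ∀ j, MeasurableSet (B j) := fun j =>
    measurableSet_lt measurable_const
      (((Finset.measurable_sum _ fun i _ => measurable_pi_apply i).div_const _).sub_const _).abs
  have hBp : ∀ j, (Measure.pi fun _ : Fin n => p.1).real (B j) ≤ 0.16 := by
    intro j
    have hc := card_filter_div_eq hb0 hkb j.2
    have h1 := measureReal_groupMean_le p.2 hx0 hx
      (T := Finset.univ.filter fun i : Fin n => i.val / b = j.val) (by rw [hc]; exact hb0)
      (by
        rw [hc, ← mul_div_assoc, le_div_iff₀ hn']
        nlinarith)
      (by
        rw [hc, show (b : ℝ) * (0.45 * (Real.log (1 / δ) / n))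
          = 0.45 * (b * Real.log (1 / δ)) / n by ring, div_le_iff₀ hn']
        nlinarith)
    rw [hc, ← errFn_eq_errAt] at h1
    exact h1
  have hBS : ∀ S : Finset (Fin k), (Measure.pi fun _ : Fin n => p.1).real (⋂ j ∈ S, B j)
      ≤ 0.16 ^ S.card := by
    intro S
    have h1 := measureReal_pi_biInter_le (p := p.1) (fun i : Fin n => i.val / b)
      (B := fun j : ℕ => {ω : Fin n → ℝ | 10 * errFn n δ p
        < |(∑ i : Fin n with i.val / b = j, ω i) / b - mean p.1|})
      (fun j => measurableSet_lt measurable_const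
        (((Finset.measurable_sum _ fun i _ => measurable_pi_apply i).div_const _).sub_const _).abs)
      (fun j x y hxy hxB => by
        have e : ∑ i : Fin n with i.val / b = j, y i = ∑ i : Fin n with i.val / b = j, x i :=
          Finset.sum_congr rfl fun i hi => (hxy i (Finset.mem_filter.1 hi).2).symm
        rw [mem_ofPred_eq] at hxB ⊢
        rwa [e])
      (q := 0.16) (S.map Fin.valEmbedding) (fun j hj => by
        obtain ⟨j, -, rfl⟩ := Finset.mem_map.1 hj
        exact hBp j)
    rw [Finset.card_map] at h1
    simpa [B] using h1
  have hmain := (measureReal_half_le hBS (E := {ω | 10 * errFn n δ p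
      < |medianOfMeans n δ ω - mean p.1|}) fun ω hω =>
    ⟨_, le_two_mul_card_of_lt_abs_median_sub hω, fun j hj => (Finset.mem_filter.1 hj).2⟩).trans
      (pow_numGroups_le hδ0)
  have hmeas : MeasurableSet {ω | |medianOfMeans n δ ω - mean p.1| ≤ e} :=
    measurableSet_le ((measurable_medianOfMeans n δ).sub_const _).abs measurable_const
  rw [ErrorLE, samples]
  have hc := probReal_compl_eq_one_sub (μ := Measure.pi fun _ : Fin n => p.1) hmeas
  have hle : (Measure.pi fun _ : Fin n => p.1).real {ω | |medianOfMeans n δ ω - mean p.1| ≤ e}ᶜ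
      ≤ δ := by
    refine (measureReal_mono fun ω hω => ?_).trans hmain
    simp only [mem_compl_iff, mem_ofPred_eq, not_le] at hω
    exact he.trans_lt hω
  linarith

end MeanEst

theorem mainTheorem3 :
    ∃ c : ℝ, 0 < c ∧ ∃ κ₀ : ℝ, 1 < κ₀ ∧ ∃ κ₁ : ℝ, 1 < κ₁ ∧
      ∀ (n : ℕ) (δ : ℝ), 0 < n → 0 < δ → δ ≤ c → Real.log (1 / δ) / n ≤ c →
        (∀ κ : ℝ, κ₀ ≤ κ →
          MeanEst.IsParetoBound n δ (MeanEst.nbhd n δ)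
            (fun p => 1 / κ * min (MeanEst.errFn ((n : ℝ) / 3) δ p) (MeanEst.errFn n δ p))) ∧
        (∀ κ : ℝ, κ₁ ≤ κ →
          MeanEst.IsNbhdOptimalVia κ 3 n δ (MeanEst.nbhd n δ) (MeanEst.medianOfMeans n δ)
            (fun m p => 1 / κ₀ * MeanEst.errFn m δ p) ∧
          MeanEst.IsNbhdOptimal κ 3 n δ (MeanEst.nbhd n δ) (MeanEst.medianOfMeans n δ)) := by
  refine ⟨1 / 1000, by norm_num, 2525, by norm_num, 25250, by norm_num,
    fun n δ hn hδ0 hδ hx => ⟨fun κ hκ => MeanEst.isParetoBound_min_errFn hn hδ0 hδ hx hκ,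
      fun κ hκ => ?_⟩⟩
  have h : MeanEst.IsNbhdOptimalVia κ 3 n δ (MeanEst.nbhd n δ) (MeanEst.medianOfMeans n δ)
      (fun m p => 1 / 2525 * MeanEst.errFn m δ p) := by
    refine ⟨by linarith, by norm_num, MeanEst.measurable_medianOfMeans n δ,
      fun m p => mul_nonneg (by norm_num) (MeanEst.errFn_nonneg m δ p), ?_, fun p => ?_⟩
    · simp_rw [← mul_min_of_nonneg _ _ (show (0 : ℝ) ≤ 1 / 2525 by norm_num)]
      exact MeanEst.isParetoBound_min_errFn hn hδ0 hδ hx le_rfl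
    · refine MeanEst.errorLE_medianOfMeans hn hδ0 hδ hx p ?_
      have := MeanEst.errFn_nonneg n δ p
      nlinarith
  exact ⟨h, _, h⟩
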